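/- Let $X$ be a smooth irreducible complex projective variety of dimension $n\ge 2$ and let $H$ be an ample line bundle on $X$. For a torsion-free coherent sheaf $F\neq 0$ on $X$ put $\mu_H(F)=\dfrac{c_1(F)\cdot H^{n-1}}{\operatorname{rk}F}$; a torsion-free coherent sheaf $E$ is called $\mu_H$-stable if $\mu_H(F)<\mu_H(E)$ for every nonzero coherent subsheaf $F\subset E$ with $\operatorname{rk}F<\operatorname{rk}E$. Let $E$ be a vector bundle on $X$ of rank $r\ge 2$ with $h^0(E)=\dim_{\mathbb C}H^0(X,E)=r+1$ which is globally generated, i.e. the evaluation map $ev_E\colon H^0(E)\otimes\mathcal O_X\to E$ is surjective, and $\mu_H$-stable. Put $L=\det E=\bigwedge^rE$. Let $$d_E\colon \bigwedge^rH^0(E)\to H^0(L),\qquad s_1\wedge\dots\wedge s_r\mapsto \bigl(x\mapsto s_1(x)\wedge\dots\wedge s_r(x)\bigr)$$ be the determinant map. Then: (a) $d_E$ is injective. (b) There are exact sequences $0\to L^*\xrightarrow{\ \iota\ }H^0(E)\otimes\mathcal O_X\xrightarrow{\ ev_E\ }E\to0$, and for every such $\iota$, with $\gamma\colon H^0(E)^*\otimes\mathcal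 O_X\to L$ denoting the dual of $\iota$ composed with the canonical isomorphism $L^{**}\simeq L$, one has $\operatorname{Im}(d_E)=\operatorname{Im}\bigl(H^0(\gamma)\colon H^0(H^0(E)^*\otimes\mathcal O_X)\to H^0(L)\bigr)$. -/

import Mathlib

open CategoryTheory AlgebraicGeometry TopologicalSpace Opposite

namespace StableBundle

noncomputable section

/-! ### Complex schemes: scalars -/

section Scalars

variable {X : Scheme.{0}} [X.Over (Spec (CommRingCat.of ℂ))]

/-- The ring homomorphism `ℂ → Γ(X, U)` given by the structure morphism `X ⟶ Spec ℂ`. -/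
def scalarHom (X : Scheme.{0}) [X.Over (Spec (CommRingCat.of ℂ))] (U : X.Opens) :
    ℂ →+* Γ(X, U) :=
  ((Scheme.ΓSpecIso (CommRingCat.of ℂ)).inv ≫
    (X ↘ Spec (CommRingCat.of ℂ)).appTop ≫ X.presheaf.map (homOfLE le_top).op).hom

lemma map_scalarHom {U V : X.Opens} (i : V ⟶ U) (c : ℂ) :
    X.presheaf.map i.op (scalarHom X U c) = scalarHom X V c := by
  have h : (homOfLE (le_top : U ≤ ⊤)).op ≫ i.op = (homOfLE (le_top : V ≤ ⊤)).op := rfl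
  rw [scalarHom, scalarHom, ← h, Functor.map_comp]
  rfl

instance algebraSections (U : X.Opens) : Algebra ℂ Γ(X, U) := (scalarHom X U).toAlgebra

instance moduleSections (M : X.Modules) (U : X.Opens) : Module ℂ Γ(M, U) :=
  Module.compHom _ (scalarHom X U)

instance scalarTowerSections (M : X.Modules) (U : X.Opens) :
    IsScalarTower ℂ Γ(X, U) Γ(M, U) :=
  ⟨fun c a m => by
    change (scalarHom X U c * a) • m = scalarHom X U c • a • m
    rw [mul_smul]⟩

/-- A morphism of `𝒪_X`-modules on global sections, as a `ℂ`-linear map `H⁰(M) → H⁰(N)`. -/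
def H0map {M N : X.Modules} (f : M ⟶ N) : Γ(M, ⊤) →ₗ[ℂ] Γ(N, ⊤) where
  toFun := f.app ⊤
  map_add' := map_add _
  map_smul' c m := Scheme.Modules.Hom.app_smul f (scalarHom X ⊤ c) m

end Scalars

/-! ### Sheaves of modules -/

section Modules

variable {X : Scheme.{0}}

/-- The structure sheaf as a module over itself. -/
def structureModule (X : Scheme.{0}) : X.Modules := SheafOfModules.unit X.ringCatSheaf

/-- The sheaf associated with a presheaf of `𝒪_X`-modules. -/
def sheafify (P : X.PresheafOfModules) : X.Modules :=
  (PresheafOfModules.sheafification (𝟙 X.ringCatSheaf.obj)).obj P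

/-- The canonical map from the sections of a presheaf to those of the associated sheaf. -/
def sheafifyUnit (P : X.PresheafOfModules) (U : X.Opens) : P.obj (op U) →+ Γ(sheafify P, U) :=
  ((CategoryTheory.toSheafify (Opens.grothendieckTopology X) P.presheaf).app (op U)).hom

lemma sheafifyUnit_smul (P : X.PresheafOfModules) (U : X.Opens)
    (a : X.ringCatSheaf.obj.obj (op U)) (s : P.obj (op U)) :
    sheafifyUnit P U (a • s) = (show Γ(X, U) from a) • sheafifyUnit P U s :=
  (((PresheafOfModules.sheafificationAdjunction (𝟙 X.ringCatSheaf.obj)).unit.app P).app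
    (op U)).hom.map_smul a s

/-- The morphism from the associated sheaf induced by a morphism of presheaves of modules. -/
def sheafifyDesc {P : X.PresheafOfModules} {M : X.Modules}
    (f : P ⟶ (Scheme.Modules.toPresheafOfModules X).obj M) : sheafify P ⟶ M :=
  (PresheafOfModules.sheafificationHomEquiv (𝟙 X.ringCatSheaf.obj)).symm f

lemma sheafifyDesc_eq {P : X.PresheafOfModules} {M : X.Modules}
    {f : P ⟶ (Scheme.Modules.toPresheafOfModules X).obj M} {g : sheafify P ⟶ M}
    (h : ∀ (U : X.Opens) (x : P.obj (op U)), g.app U (sheafifyUnit P U x) = f.app (op U) x) :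
    sheafifyDesc f = g := by
  refine (Equiv.symm_apply_eq _).mpr ?_
  apply (PresheafOfModules.toPresheaf _).map_injective
  ext U x
  exact (h U.unop x).symm

lemma sheafifyDesc_unit {P : X.PresheafOfModules} {M : X.Modules}
    (f : P ⟶ (Scheme.Modules.toPresheafOfModules X).obj M) (U : X.Opens) (x : P.obj (op U)) :
    (sheafifyDesc f).app U (sheafifyUnit P U x) = f.app (op U) x := by
  have h := (PresheafOfModules.sheafificationHomEquiv (𝟙 X.ringCatSheaf.obj)).apply_symm_apply f
  have h2 := congrArg (fun k => (PresheafOfModules.toPresheaf _).map k) h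
  exact ConcreteCategory.congr_hom (NatTrans.congr_app h2 (op U)) x

/-- `M ⊗ N`. -/
def tensor (M N : X.Modules) : X.Modules :=
  sheafify (PresheafOfModules.Monoidal.tensorObj (R := X.presheaf) M.val N.val)

/-- `M^{⊗ k}`. -/
def tensorPow (M : X.Modules) : ℕ → X.Modules
  | 0 => structureModule X
  | k + 1 => tensor M (tensorPow M k)

/-- The restriction map `Γ(M, U) → Γ(M, V)` for `V ≤ U`. -/
def res (M : X.Modules) {U V : X.Opens} (h : V ≤ U) : Γ(M, U) →+ Γ(M, V) :=
  (M.presheaf.map (homOfLE h).op).hom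

/-- The restriction map `Γ(X, U) → Γ(X, V)` for `V ≤ U`. -/
def resO (X : Scheme.{0}) {U V : X.Opens} (h : V ≤ U) : Γ(X, U) →+* Γ(X, V) :=
  (X.presheaf.map (homOfLE h).op).hom

lemma res_smul (M : X.Modules) {U V : X.Opens} (h : V ≤ U) (a : Γ(X, U)) (m : Γ(M, U)) :
    res M h (a • m) = resO X h a • res M h m :=
  Scheme.Modules.map_smul M (homOfLE h) a m

lemma res_res (M : X.Modules) {U V W : X.Opens} (h : V ≤ U) (k : W ≤ V) (m : Γ(M, U)) :
    res M k (res M h m) = res M (k.trans h) m := by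
  have e : (homOfLE (k.trans h)).op = (homOfLE h).op ≫ (homOfLE k).op := rfl
  rw [res, res, res, e, Functor.map_comp]
  rfl

lemma resO_resO {U V W : X.Opens} (h : V ≤ U) (k : W ≤ V) (a : Γ(X, U)) :
    resO X k (resO X h a) = resO X (k.trans h) a := by
  have e : (homOfLE (k.trans h)).op = (homOfLE h).op ≫ (homOfLE k).op := rfl
  rw [resO, resO, resO, e, Functor.map_comp]
  rfl

/-- A morphism of `𝒪_X`-modules on sections over `U`, as an `𝒪(U)`-linear map. -/
def appLin {M N : X.Modules} (f : M ⟶ N) (U : X.Opens) : Γ(M, U) →ₗ[Γ(X, U)] Γ(N, U) where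
  toFun := f.app U
  map_add' := map_add _
  map_smul' a m := Scheme.Modules.Hom.app_smul f a m

lemma res_app {M N : X.Modules} (f : M ⟶ N) {U V : X.Opens} (h : V ≤ U) (m : Γ(M, U)) :
    res N h (f.app U m) = f.app V (res M h m) :=
  (ConcreteCategory.congr_hom (f.mapPresheaf.naturality (homOfLE h).op) m).symm

/-! #### Exterior powers -/

/-- The map on exterior powers induced by a semilinear map. -/
def exteriorMapSL {R S : Type} [CommRing R] [CommRing S] (σ : R →+* S) {M N : Type}
    [AddCommGroup M] [Module R M] [AddCommGroup N] [Module S N] (g : M →ₛₗ[σ] N) (n : ℕ) :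
    (⋀[R]^n M) →ₛₗ[σ] (⋀[S]^n N) :=
  letI : Module R (⋀[S]^n N) := Module.compHom _ σ
  let F : (⋀[R]^n M) →ₗ[R] (⋀[S]^n N) := exteriorPower.alternatingMapLinearEquiv
    { toFun := fun m => exteriorPower.ιMulti S n (fun i => g (m i))
      map_update_add' := fun m i x y => by
        have key : ∀ z, (fun j => g (Function.update m i z j)) =
            Function.update (fun j => g (m j)) i (g z) := fun z => by
          ext j; by_cases h : j = i
          · subst h; simp
          · simp [h]
        have hd : ‹DecidableEq (Fin n)› = instDecidableEqFin n := Subsingleton.elim _ _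
        subst hd
        rw [key, key, key, map_add, AlternatingMap.map_update_add]
      map_update_smul' := fun m i c x => by
        have key : ∀ z, (fun j => g (Function.update m i z j)) =
            Function.update (fun j => g (m j)) i (g z) := fun z => by
          ext j; by_cases h : j = i
          · subst h; simp
          · simp [h]
        have hd : ‹DecidableEq (Fin n)› = instDecidableEqFin n := Subsingleton.elim _ _
        subst hd
        rw [key, key, map_smulₛₗ, AlternatingMap.map_update_smul]
        rfl
      map_eq_zero_of_eq' := fun m i j h hij =>
        (exteriorPower.ιMulti S n).map_eq_zero_of_eq _ (by simp [h]) hij }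
  { toFun := F
    map_add' := F.map_add
    map_smul' := fun c x => F.map_smul c x }

lemma exteriorMapSL_ιMulti {R S : Type} [CommRing R] [CommRing S] (σ : R →+* S) {M N : Type}
    [AddCommGroup M] [Module R M] [AddCommGroup N] [Module S N] (g : M →ₛₗ[σ] N) (n : ℕ)
    (m : Fin n → M) :
    exteriorMapSL σ g n (exteriorPower.ιMulti R n m) =
      exteriorPower.ιMulti S n (fun i => g (m i)) := by
  let : Module R (⋀[S]^n N) := Module.compHom _ σ
  exact exteriorPower.alternatingMapLinearEquiv_apply_ιMulti (R := R) _ _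

/-- The restriction map of `M` as a semilinear map. -/
def resSL (M : X.Modules) {U V : X.Opens} (i : V ⟶ U) :
    Γ(M, U) →ₛₗ[(X.presheaf.map i.op).hom] Γ(M, V) where
  toFun := M.presheaf.map i.op
  map_add' := map_add _
  map_smul' a m := Scheme.Modules.map_smul M i a m

/-- The restriction map of `U ↦ ⋀ⁿ_{𝒪(U)} M(U)`. -/
def exteriorRes (M : X.Modules) (n : ℕ) {U V : X.Opens} (i : V ⟶ U) :
    (⋀[Γ(X, U)]^n Γ(M, U)) →ₛₗ[(X.presheaf.map i.op).hom] (⋀[Γ(X, V)]^n Γ(M, V)) :=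
  exteriorMapSL _ (resSL M i) n

lemma exteriorRes_id (M : X.Modules) (n : ℕ) (U : X.Opens) (x : ⋀[Γ(X, U)]^n Γ(M, U)) :
    exteriorRes M n (𝟙 U) x = x := by
  have hx : x ∈ Submodule.span Γ(X, U) (Set.range (exteriorPower.ιMulti Γ(X, U) n
      (M := Γ(M, U)))) := by
    rw [exteriorPower.ιMulti_span]; trivial
  induction hx using Submodule.span_induction with
  | mem x h =>
    obtain ⟨m, rfl⟩ := h
    rw [exteriorRes, exteriorMapSL_ιMulti]
    congr 1
    ext j
    exact ConcreteCategory.congr_hom (M.presheaf.map_id (op U)) (m j)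
  | zero => exact map_zero _
  | add x y _ _ hx hy => rw [map_add, hx, hy]
  | smul a x _ hx =>
    rw [map_smulₛₗ, hx]
    congr 1
    exact ConcreteCategory.congr_hom (X.presheaf.map_id (op U)) a

lemma exteriorRes_comp (M : X.Modules) (n : ℕ) {U V W : X.Opens} (i : V ⟶ U) (j : W ⟶ V)
    (x : ⋀[Γ(X, U)]^n Γ(M, U)) :
    exteriorRes M n (j ≫ i) x = exteriorRes M n j (exteriorRes M n i x) := by
  have hx : x ∈ Submodule.span Γ(X, U) (Set.range (exteriorPower.ιMulti Γ(X, U) n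
      (M := Γ(M, U)))) := by
    rw [exteriorPower.ιMulti_span]; trivial
  induction hx using Submodule.span_induction with
  | mem x h =>
    obtain ⟨m, rfl⟩ := h
    rw [exteriorRes, exteriorMapSL_ιMulti, exteriorRes, exteriorRes, exteriorMapSL_ιMulti,
      exteriorMapSL_ιMulti]
    congr 1
    ext k
    exact ConcreteCategory.congr_hom (M.presheaf.map_comp i.op j.op) (m k)
  | zero => simp only [map_zero]
  | add x y _ _ hx hy => rw [map_add, hx, hy, map_add, map_add]
  | smul a x _ hx =>
    rw [map_smulₛₗ, hx, map_smulₛₗ, map_smulₛₗ]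
    congr 1
    exact ConcreteCategory.congr_hom (X.presheaf.map_comp i.op j.op) a

/-- The presheaf of abelian groups `U ↦ ⋀ⁿ_{𝒪(U)} M(U)`. -/
def exteriorAb (M : X.Modules) (n : ℕ) : X.Opensᵒᵖ ⥤ Ab.{0} where
  obj U := AddCommGrpCat.of (⋀[Γ(X, U.unop)]^n Γ(M, U.unop))
  map i := AddCommGrpCat.ofHom (exteriorRes M n i.unop).toAddMonoidHom
  map_id U := AddCommGrpCat.hom_ext (AddMonoidHom.ext fun x => exteriorRes_id M n U.unop x)
  map_comp i j := AddCommGrpCat.hom_ext (AddMonoidHom.ext fun x =>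
    exteriorRes_comp M n i.unop j.unop x)

instance exteriorAbModule (M : X.Modules) (n : ℕ) (U : X.Opensᵒᵖ) :
    Module (X.ringCatSheaf.obj.obj U) ((exteriorAb M n).obj U) :=
  inferInstanceAs (Module Γ(X, U.unop) (⋀[Γ(X, U.unop)]^n Γ(M, U.unop)))

/-- The presheaf of modules `U ↦ ⋀ⁿ_{𝒪(U)} M(U)`. -/
def exteriorPresheaf (M : X.Modules) (n : ℕ) : X.PresheafOfModules :=
  PresheafOfModules.ofPresheaf (exteriorAb M n)
    (fun _ _ i a x => map_smulₛₗ (exteriorRes M n i.unop) a x)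

/-- The exterior power `⋀ⁿ M` of a sheaf of modules. -/
def extPow (n : ℕ) (M : X.Modules) : X.Modules := sheafify (exteriorPresheaf M n)

/-- The canonical map `⋀ⁿ_{𝒪(U)} M(U) → Γ(⋀ⁿ M, U)`. -/
def toExtPow (n : ℕ) (M : X.Modules) (U : X.Opens) :
    (⋀[Γ(X, U)]^n Γ(M, U)) →ₗ[Γ(X, U)] Γ(extPow n M, U) where
  toFun := sheafifyUnit (exteriorPresheaf M n) U
  map_add' := map_add _
  map_smul' a s := sheafifyUnit_smul (exteriorPresheaf M n) U a s

/-! #### The dual sheaf -/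

/-- Sections over `U` of the dual `M^* = ℋom(M, 𝒪_X)`: morphisms `M|_U → 𝒪_U`, i.e. families of
`𝒪(V)`-linear maps `M(V) → 𝒪(V)`, `V ⊆ U` open, compatible with restriction. -/
@[ext]
structure DualSection (M : X.Modules) (U : X.Opens) : Type where
  toFun : ∀ V : X.Opens, V ≤ U → (Γ(M, V) →ₗ[Γ(X, V)] Γ(X, V))
  compat : ∀ (V W : X.Opens) (hV : V ≤ U) (h : W ≤ V) (m : Γ(M, V)),
    resO X h (toFun V hV m) = toFun W (h.trans hV) (res M h m)

namespace DualSection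

variable {M N : X.Modules} {U : X.Opens}

instance : Zero (DualSection M U) := ⟨⟨fun _ _ => 0, fun _ _ _ _ _ => map_zero _⟩⟩
instance : Add (DualSection M U) := ⟨fun φ ψ => ⟨fun V h => φ.toFun V h + ψ.toFun V h,
  fun V W hV h m => by
    rw [LinearMap.add_apply, map_add, φ.compat, ψ.compat, LinearMap.add_apply]⟩⟩
instance : Neg (DualSection M U) := ⟨fun φ => ⟨fun V h => -φ.toFun V h,
  fun V W hV h m => by rw [LinearMap.neg_apply, map_neg, φ.compat, LinearMap.neg_apply]⟩⟩
instance : SMul Γ(X, U) (DualSection M U) := ⟨fun a φ => ⟨fun V h => resO X h a • φ.toFun V h,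
  fun V W hV h m => by
    rw [LinearMap.smul_apply, smul_eq_mul, map_mul, φ.compat, resO_resO, LinearMap.smul_apply,
      smul_eq_mul]⟩⟩

lemma add_toFun (φ ψ : DualSection M U) (V : X.Opens) (h : V ≤ U) :
    (φ + ψ).toFun V h = φ.toFun V h + ψ.toFun V h := rfl
lemma zero_toFun (V : X.Opens) (h : V ≤ U) : (0 : DualSection M U).toFun V h = 0 := rfl
lemma neg_toFun (φ : DualSection M U) (V : X.Opens) (h : V ≤ U) :
    (-φ).toFun V h = -φ.toFun V h := rfl
lemma smul_toFun (a : Γ(X, U)) (φ : DualSection M U) (V : X.Opens) (h : V ≤ U) :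
    (a • φ).toFun V h = resO X h a • φ.toFun V h := rfl

instance : AddCommGroup (DualSection M U) where
  add_assoc a b c := by ext1; funext V h; simp only [add_toFun, add_assoc]
  zero_add a := by ext1; funext V h; simp only [add_toFun, zero_toFun, zero_add]
  add_zero a := by ext1; funext V h; simp only [add_toFun, zero_toFun, add_zero]
  add_comm a b := by ext1; funext V h; simp only [add_toFun, add_comm]
  neg_add_cancel a := by
    ext1; funext V h; simp only [add_toFun, neg_toFun, zero_toFun, neg_add_cancel]
  nsmul := nsmulRec
  zsmul := zsmulRec

instance : Module Γ(X, U) (DualSection M U) where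
  one_smul a := by ext1; funext V h; simp only [smul_toFun, map_one, one_smul]
  mul_smul a b c := by ext1; funext V h; simp only [smul_toFun, map_mul, mul_smul]
  smul_zero a := by ext1; funext V h; simp only [smul_toFun, zero_toFun, smul_zero]
  smul_add a b c := by ext1; funext V h; simp only [smul_toFun, add_toFun, smul_add]
  add_smul a b c := by ext1; funext V h; simp only [smul_toFun, add_toFun, map_add, add_smul]
  zero_smul a := by ext1; funext V h; simp only [smul_toFun, zero_toFun, map_zero, zero_smul]

/-- Restriction of sections of the dual. -/
def restrict {V : X.Opens} (h : V ≤ U) : DualSection M U →+ DualSection M V where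
  toFun φ := ⟨fun W k => φ.toFun W (k.trans h), fun _ _ _ _ _ => φ.compat _ _ _ _ _⟩
  map_zero' := rfl
  map_add' _ _ := rfl

lemma restrict_smul {V : X.Opens} (h : V ≤ U) (a : Γ(X, U)) (φ : DualSection M U) :
    restrict h (a • φ) = resO X h a • restrict h φ := by
  apply DualSection.ext
  funext W k
  change resO X _ a • φ.toFun W _ = resO X k (resO X h a) • φ.toFun W _
  rw [resO_resO]

/-- A morphism `M ⟶ 𝒪_X` as a global section of the dual. -/
def ofHom (f : M ⟶ structureModule X) : DualSection M ⊤ where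
  toFun V _ := appLin f V
  compat _ _ _ h m := res_app f h m

/-- Precomposition with a morphism. -/
def precomp (f : M ⟶ N) (φ : DualSection N U) : DualSection M U where
  toFun V h := (φ.toFun V h).comp (appLin f V)
  compat V W hV h m := by
    change resO X h (φ.toFun V hV (f.app V m)) = φ.toFun W _ (f.app W (res M h m))
    rw [φ.compat, res_app]

lemma precomp_smul (f : M ⟶ N) (a : Γ(X, U)) (φ : DualSection N U) :
    precomp f (a • φ) = a • precomp f φ := by
  apply DualSection.ext
  funext V h
  rfl

lemma precomp_restrict (f : M ⟶ N) {V : X.Opens} (h : V ≤ U) (φ : DualSection N U) :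
    precomp f (restrict h φ) = restrict h (precomp f φ) := rfl

/-- Evaluation at a section `m` of `M`, as a section of the bidual, at the level of values. -/
def eval {V : X.Opens} (m : Γ(M, V)) : DualSection M V →ₗ[Γ(X, V)] Γ(X, V) where
  toFun φ := φ.toFun V le_rfl m
  map_add' _ _ := rfl
  map_smul' a φ := by
    rw [smul_toFun]
    have : resO X (le_refl V) a = a := ConcreteCategory.congr_hom (X.presheaf.map_id (op V)) a
    rw [this]; rfl

end DualSection

/-- The presheaf of abelian groups `U ↦ Hom(M|_U, 𝒪_U)`. -/
def dualAb (M : X.Modules) : X.Opensᵒᵖ ⥤ Ab.{0} where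
  obj U := AddCommGrpCat.of (DualSection M U.unop)
  map i := AddCommGrpCat.ofHom (DualSection.restrict (leOfHom i.unop))

instance dualAbModule (M : X.Modules) (U : X.Opensᵒᵖ) :
    Module (X.ringCatSheaf.obj.obj U) ((dualAb M).obj U) :=
  inferInstanceAs (Module Γ(X, U.unop) (DualSection M U.unop))

/-- The presheaf of modules `U ↦ Hom(M|_U, 𝒪_U)`. -/
def dualPresheaf (M : X.Modules) : X.PresheafOfModules :=
  PresheafOfModules.ofPresheaf (dualAb M)
    (fun _ _ i a φ => DualSection.restrict_smul (leOfHom i.unop) a φ)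

lemma existsUnique_glueO {ι : Type} (V : X.Opens) (W : ι → X.Opens) (hW : ∀ i, W i ≤ V)
    (hc : V ≤ iSup W) (s : ∀ i, Γ(X, W i))
    (hs : ∀ i j, resO X (inf_le_left : W i ⊓ W j ≤ W i) (s i) = resO X inf_le_right (s j)) :
    ∃! t : Γ(X, V), ∀ i, resO X (hW i) t = s i :=
  X.sheaf.existsUnique_gluing' W V (fun i => homOfLE (hW i)) hc s hs

lemma dualAb_isSheaf (M : X.Modules) : TopCat.Presheaf.IsSheaf (X := X) (dualAb M) := by
  rw [TopCat.Presheaf.isSheaf_iff_isSheafUniqueGluing]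
  intro ι U s hs
  let s' (i : ι) : DualSection M (U i) := s i
  have hs' (i j : ι) (W : X.Opens) (hi : W ≤ U i) (hj : W ≤ U j) :
      (s' i).toFun W hi = (s' j).toFun W hj :=
    congrArg (fun φ : DualSection M (U i ⊓ U j) => φ.toFun W (le_inf hi hj)) (hs i j)
  have glue (V : X.Opens) (hV : V ≤ iSup U) (m : Γ(M, V)) : ∃! t : Γ(X, V), ∀ i,
      resO X (inf_le_left : V ⊓ U i ≤ V) t =
        (s' i).toFun (V ⊓ U i) inf_le_right (res M inf_le_left m) := by
    refine existsUnique_glueO V (fun i => V ⊓ U i) (fun i => inf_le_left) ?_ _ ?_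
    · rw [← inf_iSup_eq]; exact le_inf le_rfl hV
    · intro i j
      rw [(s' i).compat, (s' j).compat, res_res, res_res]
      exact DFunLike.congr_fun (hs' i j _ _ _) _
  choose t ht htu using glue
  let φ : DualSection M (iSup U) :=
    { toFun := fun V hV =>
        { toFun := t V hV
          map_add' := fun m m' => (htu V hV _ _ fun i => by
            rw [map_add, ht, ht, map_add, map_add]).symm
          map_smul' := fun a m => (htu V hV _ _ fun i => by
            rw [RingHom.id_apply, smul_eq_mul, map_mul, ht, res_smul, map_smul, smul_eq_mul]).symm }
      compat := fun V W hV h m => htu W _ _ _ fun i => by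
        have e := congrArg (resO X (inf_le_inf_right (U i) h)) (ht V hV m i)
        rw [resO_resO, (s' i).compat, res_res] at e
        rw [resO_resO, res_res]
        exact e }
  refine ⟨φ, fun i => ?_, fun ψ hψ => ?_⟩
  · change DualSection.restrict (le_iSup U i) φ = s' i
    apply DualSection.ext
    funext V hV
    ext m
    refine htu V _ m _ (fun j => ?_) |>.symm
    rw [(s' i).compat]
    exact DFunLike.congr_fun (hs' i j _ _ _) _
  · apply DualSection.ext
    funext V hV
    ext m
    refine htu V hV m _ fun i => ?_
    have hi : DualSection.restrict (le_iSup U i) ψ = s' i := hψ i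
    rw [← hi]
    exact DualSection.compat ψ V (V ⊓ U i) hV inf_le_left m

/-- The dual `M^* = ℋom(M, 𝒪_X)`. -/
def dual (M : X.Modules) : X.Modules :=
  SheafOfModules.mk (R := X.ringCatSheaf) (dualPresheaf M) (dualAb_isSheaf M)

/-- A section `m` of `M` over `U` as a section of the bidual: it sends `φ ∈ M^*(V)` to
`φ(m|_V)`. -/
def bidualSection (M : X.Modules) {U : X.Opens} (m : Γ(M, U)) : DualSection (dual M) U where
  toFun V h := DualSection.eval (res M h m)
  compat V W hV h φ := by
    change resO X h ((show DualSection M V from φ).toFun V le_rfl (res M hV m)) =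
      (show DualSection M V from φ).toFun W h (res M (h.trans hV) m)
    rw [DualSection.compat, res_res]

lemma bidualSection_add (M : X.Modules) {U : X.Opens} (m m' : Γ(M, U)) :
    bidualSection M (m + m') = bidualSection M m + bidualSection M m' := by
  apply DualSection.ext
  funext V h
  ext φ
  change (show DualSection M V from φ).toFun V le_rfl (res M h (m + m')) = _
  rw [map_add, map_add]
  rfl

lemma bidualSection_zero (M : X.Modules) {U : X.Opens} :
    bidualSection M (0 : Γ(M, U)) = 0 := by
  have h := bidualSection_add M (0 : Γ(M, U)) 0
  rwa [add_zero, left_eq_add] at h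

lemma bidualSection_smul (M : X.Modules) {U : X.Opens} (a : Γ(X, U)) (m : Γ(M, U)) :
    bidualSection M (a • m) = a • bidualSection M m := by
  apply DualSection.ext
  funext V h
  ext φ
  change (show DualSection M V from φ).toFun V le_rfl (res M h (a • m)) = _
  rw [res_smul, map_smul]
  rfl

lemma bidualSection_res (M : X.Modules) {U V : X.Opens} (h : V ≤ U) (m : Γ(M, U)) :
    bidualSection M (res M h m) = DualSection.restrict h (bidualSection M m) := by
  apply DualSection.ext
  funext W k
  ext φ
  change (show DualSection M W from φ).toFun W le_rfl (res M k (res M h m)) = _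
  rw [res_res]
  rfl

/-- The dual (transpose) `N^* ⟶ M^*` of a morphism `M ⟶ N`. -/
def dualMap {M N : X.Modules} (f : M ⟶ N) : dual N ⟶ dual M :=
  SheafOfModules.Hom.mk (R := X.ringCatSheaf) (PresheafOfModules.homMk
    (M₁ := dualPresheaf N) (M₂ := dualPresheaf M)
    { app := fun U => AddCommGrpCat.ofHom
        { toFun := DualSection.precomp f
          map_zero' := rfl
          map_add' := fun _ _ => rfl }
      naturality := fun U V i => AddCommGrpCat.hom_ext (AddMonoidHom.ext fun φ =>
        DualSection.precomp_restrict f (leOfHom i.unop) φ) }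
    (fun _ a φ => DualSection.precomp_smul f a φ))

/-- The canonical morphism `M ⟶ M^{**}`. -/
def toBidual (M : X.Modules) : M ⟶ dual (dual M) :=
  SheafOfModules.Hom.mk (R := X.ringCatSheaf) (PresheafOfModules.homMk
    (M₁ := M.val) (M₂ := dualPresheaf (dual M))
    { app := fun U => AddCommGrpCat.ofHom
        { toFun := fun m => bidualSection M (U := U.unop) m
          map_zero' := bidualSection_zero M
          map_add' := bidualSection_add M }
      naturality := fun U V i => by
        ext m; exact bidualSection_res M (leOfHom i.unop) m }
    (fun U a m => bidualSection_smul M (U := U.unop) a m))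

end Modules

/-! ### Scalar endomorphisms and cohomology -/

section Cohomology

variable {X : Scheme.{0}} [X.Over (Spec (CommRingCat.of ℂ))]

/-- Multiplication by `c ∈ ℂ` as an endomorphism of a sheaf of modules. -/
def scalarEnd (M : X.Modules) (c : ℂ) : M ⟶ M :=
  SheafOfModules.Hom.mk (R := X.ringCatSheaf) (PresheafOfModules.homMk
    (M₁ := M.val) (M₂ := M.val)
    { app := fun U => AddCommGrpCat.ofHom
        (DistribSMul.toAddMonoidHom Γ(M, U.unop) (scalarHom X U.unop c))
      naturality := fun U V i => AddCommGrpCat.hom_ext (AddMonoidHom.ext fun m => by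
        refine Eq.symm ((res_smul M (leOfHom i.unop) (scalarHom X U.unop c) m).trans ?_)
        exact congrArg (· • _) (map_scalarHom i.unop c)) }
    (fun U (a : Γ(X, U.unop)) (m : Γ(M, U.unop)) => smul_comm (scalarHom X U.unop c) a m))

lemma scalarEnd_app (M : X.Modules) (c : ℂ) (U : X.Opens) (m : Γ(M, U)) :
    (scalarEnd M c).app U m = scalarHom X U c • m := rfl

lemma scalarEnd_one (M : X.Modules) : scalarEnd M 1 = 𝟙 M := by
  ext U m
  rw [scalarEnd_app, map_one, one_smul]; rfl

lemma scalarEnd_mul (M : X.Modules) (c d : ℂ) :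
    scalarEnd M (c * d) = scalarEnd M d ≫ scalarEnd M c := by
  ext U m
  rw [scalarEnd_app, map_mul, mul_smul]; rfl

lemma scalarEnd_add (M : X.Modules) (c d : ℂ) :
    scalarEnd M (c + d) = scalarEnd M c + scalarEnd M d := by
  ext U m
  rw [scalarEnd_app, map_add, add_smul]; rfl

/-- The sheaf cohomology group `Hⁱ(X, M)`. -/
def cohomology (M : X.Modules) (i : ℕ) : Type :=
  Sheaf.H ((SheafOfModules.toSheaf X.ringCatSheaf).obj M) i

instance (M : X.Modules) (i : ℕ) : AddCommGroup (cohomology M i) :=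
  inferInstanceAs (AddCommGroup (Sheaf.H ((SheafOfModules.toSheaf X.ringCatSheaf).obj M) i))

/-- The map induced on cohomology. -/
def cohomologyMap {M N : X.Modules} (f : M ⟶ N) (i : ℕ) : cohomology M i →+ cohomology N i :=
  Sheaf.H.map ((SheafOfModules.toSheaf X.ringCatSheaf).map f) i

lemma cohomologyMap_scalarEnd_add {M : X.Modules} {i : ℕ} (c d : ℂ) (x : cohomology M i) :
    cohomologyMap (scalarEnd M (c + d)) i x =
      cohomologyMap (scalarEnd M c) i x + cohomologyMap (scalarEnd M d) i x := by
  rw [scalarEnd_add]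
  refine (congrArg (fun f => Sheaf.H.map f i x)
    ((SheafOfModules.toSheaf X.ringCatSheaf).map_add)).trans (Sheaf.H.map_add_apply _ _ x)

/-- The complex vector space structure of `Hⁱ(X, M)`: `c ∈ ℂ` acts by functoriality. -/
instance (M : X.Modules) (i : ℕ) : Module ℂ (cohomology M i) where
  smul c x := cohomologyMap (scalarEnd M c) i x
  one_smul x := by
    change cohomologyMap (scalarEnd M 1) i x = x
    rw [scalarEnd_one]
    refine (congrArg (fun f => Sheaf.H.map f i x)
      ((SheafOfModules.toSheaf X.ringCatSheaf).map_id M)).trans (Sheaf.H.map_id_apply x)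
  mul_smul c d x := by
    change cohomologyMap (scalarEnd M (c * d)) i x =
      cohomologyMap (scalarEnd M c) i (cohomologyMap (scalarEnd M d) i x)
    rw [scalarEnd_mul]
    refine (congrArg (fun f => Sheaf.H.map f i x)
      ((SheafOfModules.toSheaf X.ringCatSheaf).map_comp _ _)).trans (Sheaf.H.map_comp_apply _ _ x)
  smul_zero c := map_zero (cohomologyMap (scalarEnd M c) i)
  smul_add c := map_add (cohomologyMap (scalarEnd M c) i)
  add_smul := cohomologyMap_scalarEnd_add
  zero_smul x := by
    have h := cohomologyMap_scalarEnd_add (M := M) (i := i) 0 0 x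
    rwa [add_zero, left_eq_add] at h

/-- The Euler characteristic `χ(M) = ∑ᵢ (-1)ⁱ dim Hⁱ(X, M)`. -/
def eulerChar (M : X.Modules) : ℤ :=
  ∑ᶠ i : ℕ, (-1) ^ i * (Module.finrank ℂ (cohomology M i) : ℤ)

end Cohomology

/-! ### Trivial bundles and evaluation -/

section Evaluation

variable {X : Scheme.{0}} [X.Over (Spec (CommRingCat.of ℂ))]

/-- Restriction of functions as a `ℂ`-linear map. -/
def resC {U V : X.Opens} (i : V ⟶ U) : Γ(X, U) →ₗ[ℂ] Γ(X, V) where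
  toFun := X.presheaf.map i.op
  map_add' := map_add _
  map_smul' c a := by
    rw [Algebra.smul_def, map_mul, RingHom.id_apply, Algebra.smul_def]
    exact congrArg (· * _) (map_scalarHom i c)

/-- Restriction of sections as a `ℂ`-linear map. -/
def resModC (M : X.Modules) (U : X.Opens) : Γ(M, ⊤) →ₗ[ℂ] Γ(M, U) where
  toFun := res M le_top
  map_add' := map_add _
  map_smul' c m := by
    refine (res_smul M le_top (scalarHom X ⊤ c) m).trans ?_
    exact congrArg (· • _) (map_scalarHom (homOfLE (le_top : U ≤ ⊤)) c)

variable (X) in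
/-- The presheaf of abelian groups `U ↦ 𝒪(U) ⊗_ℂ W`. -/
def trivAb (W : Type) [AddCommGroup W] [Module ℂ W] : X.Opensᵒᵖ ⥤ Ab.{0} where
  obj U := AddCommGrpCat.of (TensorProduct ℂ Γ(X, U.unop) W)
  map i := AddCommGrpCat.ofHom ((resC i.unop).rTensor W).toAddMonoidHom
  map_id U := by
    refine AddCommGrpCat.hom_ext (AddMonoidHom.ext fun x => ?_)
    have : resC (𝟙 U.unop) = LinearMap.id (R := ℂ) (M := Γ(X, U.unop)) := by
      ext a; exact ConcreteCategory.congr_hom (X.presheaf.map_id U) a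
    change (resC (𝟙 U.unop)).rTensor W x = x
    rw [this, LinearMap.rTensor_id]; rfl
  map_comp {U V T} i j := by
    refine AddCommGrpCat.hom_ext (AddMonoidHom.ext fun x => ?_)
    have : resC (j.unop ≫ i.unop) = (resC j.unop).comp (resC (X := X) i.unop) := by
      ext a; exact ConcreteCategory.congr_hom (X.presheaf.map_comp i j) a
    change (resC (j.unop ≫ i.unop)).rTensor W x =
      (resC j.unop).rTensor W ((resC i.unop).rTensor W x)
    rw [this, LinearMap.rTensor_comp]; rfl

instance trivAbModule (W : Type) [AddCommGroup W] [Module ℂ W] (U : X.Opensᵒᵖ) :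
    Module (X.ringCatSheaf.obj.obj U) ((trivAb X W).obj U) :=
  inferInstanceAs (Module Γ(X, U.unop) (TensorProduct ℂ Γ(X, U.unop) W))

lemma rTensor_resC_smul (W : Type) [AddCommGroup W] [Module ℂ W] {U V : X.Opens} (i : V ⟶ U)
    (a : Γ(X, U)) (x : TensorProduct ℂ Γ(X, U) W) :
    (resC i).rTensor W (a • x) = X.presheaf.map i.op a • (resC i).rTensor W x := by
  induction x with
  | zero => simp only [smul_zero, map_zero]
  | add x y hx hy => rw [smul_add, map_add, hx, hy, map_add, smul_add]
  | tmul b w =>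
    rw [TensorProduct.smul_tmul', LinearMap.rTensor_tmul, LinearMap.rTensor_tmul,
      TensorProduct.smul_tmul']
    exact congrArg (TensorProduct.tmul ℂ · w) (map_mul (X.presheaf.map i.op).hom a b)

variable (X) in
/-- The presheaf of modules `U ↦ 𝒪(U) ⊗_ℂ W`. -/
def trivPresheaf (W : Type) [AddCommGroup W] [Module ℂ W] : X.PresheafOfModules :=
  PresheafOfModules.ofPresheaf (trivAb X W) (fun _ _ i a x => rTensor_resC_smul W i.unop a x)

variable (X) in
/-- The sheaf `W ⊗ 𝒪_X` for a complex vector space `W`. -/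
def triv (W : Type) [AddCommGroup W] [Module ℂ W] : X.Modules := sheafify (trivPresheaf X W)

/-- The map `𝒪(U) ⊗ W → Γ(M, U)`, `a ⊗ w ↦ a • φ(w)|_U`. -/
def trivDescApp {W : Type} [AddCommGroup W] [Module ℂ W] {M : X.Modules} (φ : W →ₗ[ℂ] Γ(M, ⊤))
    (U : X.Opens) : TensorProduct ℂ Γ(X, U) W →ₗ[Γ(X, U)] Γ(M, U) :=
  ((resModC M U).comp φ).liftBaseChange Γ(X, U)

lemma trivDescApp_res {W : Type} [AddCommGroup W] [Module ℂ W] {M : X.Modules}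
    (φ : W →ₗ[ℂ] Γ(M, ⊤)) {U V : X.Opens} (i : V ⟶ U) (x : TensorProduct ℂ Γ(X, U) W) :
    trivDescApp φ V ((resC i).rTensor W x) = res M (leOfHom i) (trivDescApp φ U x) := by
  induction x with
  | zero => simp only [map_zero]
  | add x y hx hy => rw [map_add, map_add, hx, hy, map_add, map_add]
  | tmul b w =>
    rw [LinearMap.rTensor_tmul, trivDescApp, trivDescApp, LinearMap.liftBaseChange_tmul,
      LinearMap.liftBaseChange_tmul, res_smul]
    change _ • res M le_top (φ w) = _ • res M _ (res M le_top (φ w))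
    rw [res_res]
    rfl

/-- The map `𝒪(U) ⊗ W → Γ(M, U)` as a morphism of presheaves of modules. -/
def trivDescPre {W : Type} [AddCommGroup W] [Module ℂ W] {M : X.Modules} (φ : W →ₗ[ℂ] Γ(M, ⊤)) :
    trivPresheaf X W ⟶ (Scheme.Modules.toPresheafOfModules X).obj M :=
  PresheafOfModules.homMk (M₁ := trivPresheaf X W) (M₂ := M.val)
    { app := fun U => AddCommGrpCat.ofHom (trivDescApp φ U.unop).toAddMonoidHom
      naturality := fun _ _ i => AddCommGrpCat.hom_ext (AddMonoidHom.ext fun x =>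
        trivDescApp_res φ i.unop x) }
    (fun U a x => (trivDescApp φ U.unop).map_smul a x)

/-- The morphism `W ⊗ 𝒪_X ⟶ M` induced by a linear map `φ : W → H⁰(M)`. -/
def trivDesc {W : Type} [AddCommGroup W] [Module ℂ W] {M : X.Modules} (φ : W →ₗ[ℂ] Γ(M, ⊤)) :
    triv X W ⟶ M :=
  sheafifyDesc (trivDescPre φ)

lemma trivDesc_eq {W : Type} [AddCommGroup W] [Module ℂ W] {M : X.Modules}
    {φ : W →ₗ[ℂ] Γ(M, ⊤)} {g : triv X W ⟶ M}
    (h : ∀ (U : X.Opens) (x : TensorProduct ℂ Γ(X, U) W),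
      g.app U (sheafifyUnit (trivPresheaf X W) U x) = trivDescApp φ U x) : trivDesc φ = g :=
  sheafifyDesc_eq h

lemma trivDesc_unit {W : Type} [AddCommGroup W] [Module ℂ W] {M : X.Modules}
    (φ : W →ₗ[ℂ] Γ(M, ⊤)) (U : X.Opens) (x : TensorProduct ℂ Γ(X, U) W) :
    (trivDesc φ).app U (sheafifyUnit (trivPresheaf X W) U x) = trivDescApp φ U x :=
  sheafifyDesc_unit (trivDescPre φ) U x

lemma trivDesc_add {W : Type} [AddCommGroup W] [Module ℂ W] {M : X.Modules}
    (φ ψ : W →ₗ[ℂ] Γ(M, ⊤)) : trivDesc (φ + ψ) = trivDesc φ + trivDesc ψ := by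
  refine trivDesc_eq fun U x => ?_
  rw [Scheme.Modules.Hom.add_app]
  refine (congrArg₂ (· + ·) (trivDesc_unit φ U x) (trivDesc_unit ψ U x)).trans ?_
  induction x with
  | zero => simp only [map_zero, add_zero]
  | add x y hx hy => rw [map_add, map_add, map_add, ← hx, ← hy]; abel
  | tmul b w =>
    simp only [trivDescApp, LinearMap.liftBaseChange_tmul, LinearMap.comp_apply,
      LinearMap.add_apply, map_add, smul_add]

lemma trivDesc_smul {W : Type} [AddCommGroup W] [Module ℂ W] {M : X.Modules} (c : ℂ)
    (φ : W →ₗ[ℂ] Γ(M, ⊤)) : trivDesc (c • φ) = trivDesc φ ≫ scalarEnd M c := by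
  refine trivDesc_eq fun U x => ?_
  rw [Scheme.Modules.Hom.comp_app]
  refine (congrArg (fun z => scalarHom X U c • z) (trivDesc_unit φ U x)).trans ?_
  induction x with
  | zero => simp only [map_zero, smul_zero]
  | add x y hx hy => rw [map_add, smul_add, map_add, ← hx, ← hy]
  | tmul b w =>
    simp only [trivDescApp, LinearMap.liftBaseChange_tmul, LinearMap.comp_apply,
      LinearMap.smul_apply, map_smul]
    exact smul_comm (scalarHom X U c) b (resModC M U (φ w))

/-- The evaluation map `ev_M : H⁰(M) ⊗ 𝒪_X ⟶ M`. -/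
def ev (M : X.Modules) : triv X Γ(M, ⊤) ⟶ M := trivDesc LinearMap.id

/-- `M` is globally generated: `ev_M` is surjective (as a morphism of sheaves). -/
def IsGloballyGenerated (M : X.Modules) : Prop := Epi (ev M)

/-- The determinant map `d_E : ⋀ʳ H⁰(E) → H⁰(⋀ʳ E)`, which sends `s₁ ∧ ⋯ ∧ s_r` to the section
`x ↦ s₁(x) ∧ ⋯ ∧ s_r(x)`; for `r` the rank of a bundle `E`, `⋀ʳ E = det E`. -/
def detMap (r : ℕ) (E : X.Modules) : (⋀[ℂ]^r Γ(E, ⊤)) →ₗ[ℂ] Γ(extPow r E, ⊤) :=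
  exteriorPower.alternatingMapLinearEquiv
    { toMultilinearMap :=
        ((toExtPow r E ⊤).compAlternatingMap
          (exteriorPower.ιMulti Γ(X, ⊤) r)).toMultilinearMap.restrictScalars ℂ
      map_eq_zero_of_eq' := fun s i j h hij =>
        ((toExtPow r E ⊤).compAlternatingMap
          (exteriorPower.ιMulti Γ(X, ⊤) r)).map_eq_zero_of_eq s h hij }

lemma detMap_ιMulti (r : ℕ) (E : X.Modules) (s : Fin r → Γ(E, ⊤)) :
    detMap r E (exteriorPower.ιMulti ℂ r s) =
      toExtPow r E ⊤ (exteriorPower.ιMulti Γ(X, ⊤) r s) :=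
  exteriorPower.alternatingMapLinearEquiv_apply_ιMulti _ _

lemma DualSection.ofHom_scalarEnd {M : X.Modules} (c : ℂ) (f : M ⟶ structureModule X) :
    DualSection.ofHom (f ≫ scalarEnd (structureModule X) c) =
      scalarHom X ⊤ c • DualSection.ofHom f := by
  apply DualSection.ext
  funext V h
  ext m
  change scalarHom X V c • f.app V m = resO X h (scalarHom X ⊤ c) • f.app V m
  rw [resO, map_scalarHom (homOfLE h) c]

variable (X) in
/-- Constants as global sections of `𝒪_X`. -/
def constSection : ℂ →ₗ[ℂ] Γ(structureModule X, ⊤) where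
  toFun c := (scalarHom X ⊤ c : Γ(X, ⊤))
  map_add' := map_add (scalarHom X ⊤)
  map_smul' := map_mul (scalarHom X ⊤)

/-- The canonical morphism `W^* ⊗ 𝒪_X ⟶ (W ⊗ 𝒪_X)^*`, sending `ξ ∈ W^*` to `w ⊗ a ↦ ξ(w) a`. -/
def trivDual (W : Type) [AddCommGroup W] [Module ℂ W] :
    triv X (Module.Dual ℂ W) ⟶ dual (triv X W) :=
  trivDesc (M := dual (triv X W))
    { toFun := fun ξ => DualSection.ofHom (trivDesc ((constSection X).comp ξ))
      map_add' := fun ξ η => by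
        rw [LinearMap.comp_add, trivDesc_add]
        rfl
      map_smul' := fun c ξ => by
        rw [LinearMap.comp_smul, trivDesc_smul]
        exact DualSection.ofHom_scalarEnd c _ }

end Evaluation

/-! ### Bundles, coherent sheaves, rank -/

section Rank

variable {X : Scheme.{0}}

/-- `M|_U` is free of rank `r`: there are `e₁, …, e_r ∈ M(U)` whose restrictions form an
`𝒪(V)`-basis of `M(V)` for every open `V ⊆ U`. -/
def IsFreeOn (M : X.Modules) (U : X.Opens) (r : ℕ) : Prop :=
  ∃ e : Fin r → Γ(M, U), ∀ (V : X.Opens) (h : V ≤ U),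
    Function.Bijective fun a : Fin r → Γ(X, V) => ∑ i, a i • res M h (e i)

/-- `M` is a vector bundle (locally free sheaf) of rank `r`. -/
def IsVectorBundle (r : ℕ) (M : X.Modules) : Prop :=
  ∀ x : X, ∃ U : X.Opens, x ∈ U ∧ IsFreeOn M U r

/-- The rank of a coherent sheaf on an integral scheme: the rank of its restriction to any
nonempty open set on which it is free. -/
def rank (M : X.Modules) : ℕ :=
  sInf {r | ∃ U : X.Opens, (U : Set X).Nonempty ∧ IsFreeOn M U r}

/-- Coherent sheaves on a locally noetherian scheme, i.e. sheaves of finite presentation. -/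
def IsCoherent (M : X.Modules) : Prop :=
  SheafOfModules.IsFinitePresentation (R := X.ringCatSheaf) M

/-- The determinant line bundle `det M = (⋀^{rk M} M)^{**}` of a coherent sheaf. -/
def detSheaf (M : X.Modules) : X.Modules := dual (dual (extPow (rank M) M))

end Rank

/-! ### Projectivity, ampleness, intersection numbers, stability -/

section Stability

attribute [local instance] MvPolynomial.gradedAlgebra

/-- The structure morphism `ℙ^N_ℂ ⟶ Spec ℂ`. -/
def projectiveSpaceStr (N : ℕ) :
    Proj (MvPolynomial.homogeneousSubmodule (Fin (N + 1)) ℂ) ⟶ Spec (CommRingCat.of ℂ) :=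
  Proj.toSpecZero (MvPolynomial.homogeneousSubmodule (Fin (N + 1)) ℂ) ≫
    Spec.map (CommRingCat.ofHom
      (algebraMap ℂ (MvPolynomial.homogeneousSubmodule (Fin (N + 1)) ℂ 0)))

/-- `X` is projective over `ℂ`: it is a closed subscheme of some `ℙ^N_ℂ`. -/
def IsProjective (X : Scheme.{0}) [X.Over (Spec (CommRingCat.of ℂ))] : Prop :=
  ∃ (N : ℕ) (i : X ⟶ Proj (MvPolynomial.homogeneousSubmodule (Fin (N + 1)) ℂ)),
    IsClosedImmersion i ∧ i ≫ projectiveSpaceStr N = X ↘ Spec (CommRingCat.of ℂ)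

variable {X : Scheme.{0}} [X.Over (Spec (CommRingCat.of ℂ))]

/-- `H` is an ample line bundle: for every coherent `F`, the sheaf `F ⊗ H^m` is globally generated
for all `m ≫ 0`. -/
structure IsAmple (H : X.Modules) : Prop where
  lineBundle : IsVectorBundle 1 H
  eventually_globallyGenerated : ∀ F : X.Modules, IsCoherent F →
    ∃ m₀ : ℕ, ∀ m ≥ m₀, IsGloballyGenerated (tensor F (tensorPow H m))

/-- The iterated difference of the Euler characteristic at `F` in the directions `L₁, …, L_k`:
`∑_{S ⊆ {1, …, k}} (-1)^{k - |S|} χ(F ⊗ ⨂_{i ∈ S} Lᵢ)`. -/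
def eulerDifference : List X.Modules → X.Modules → ℤ
  | [], F => eulerChar F
  | L :: Ls, F => eulerDifference Ls (tensor L F) - eulerDifference Ls F

/-- The intersection number `(L₁ ⋯ L_n)` of `n` line bundles on a projective variety of dimension
`n` (Snapper, Kleiman): the coefficient of `m₁ ⋯ m_n` in the polynomial
`χ(L₁^{m₁} ⊗ ⋯ ⊗ L_n^{m_n})`, which is of total degree at most `n`; this coefficient is the
iterated difference at `(0, …, 0)`. -/
def intersectionNumber (L : List X.Modules) : ℤ := eulerDifference L (structureModule X)

/-- `c₁(F) · H^{n-1}`, where `n = dim X` and `c₁(F) = c₁(det F)`. -/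
def degree (n : ℕ) (H F : X.Modules) : ℤ :=
  intersectionNumber (detSheaf F :: List.replicate (n - 1) H)

/-- The slope `μ_H(F) = c₁(F) · H^{n-1} / rk F`. -/
def slope (n : ℕ) (H F : X.Modules) : ℚ := (degree n H F : ℚ) / (rank F : ℚ)

/-- `μ_H`-stability of a torsion-free coherent sheaf `E` (for instance a vector bundle) on an
integral scheme of dimension `n`: every nonzero coherent subsheaf `F ⊆ E` with `rk F < rk E`
satisfies `μ_H(F) < μ_H(E)`. -/
def IsMuStable (n : ℕ) (H E : X.Modules) : Prop :=
  ∀ (F : X.Modules) (j : F ⟶ E), IsCoherent F → Mono j → ¬ Limits.IsZero F → rank F < rank E →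
    slope n H F < slope n H E

/-- For a globally generated bundle `E` of rank `r` with `h⁰(E) = r + 1` and `L = ⋀ʳ E = det E`:
an inclusion `ι : L^* ⟶ H⁰(E) ⊗ 𝒪_X` that identifies `L^*` with the kernel of `ev_E`, together with
its dual `γ : H⁰(E)^* ⊗ 𝒪_X ⟶ L`, where `L` is identified with `L^{**}` through the canonical map
and `H⁰(E)^* ⊗ 𝒪_X` with `(H⁰(E) ⊗ 𝒪_X)^*`. -/
structure DualEvaluation (r : ℕ) (E : X.Modules) where
  ι : dual (extPow r E) ⟶ triv X Γ(E, ⊤)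
  zero : ι ≫ ev E = 0
  exact : (ShortComplex.mk ι (ev E) zero).ShortExact
  γ : triv X (Module.Dual ℂ Γ(E, ⊤)) ⟶ extPow r E
  comm : γ ≫ toBidual (extPow r E) = trivDual Γ(E, ⊤) ≫ dualMap ι

end Stability

end

end StableBundle

/-!
Write `L = ⋀ʳ E`, let `s₀, …, s_r` be a basis of `H⁰(E)` and let
`σᵢ = (-1)ⁱ s₀ ∧ ⋯ ∧ ŝᵢ ∧ ⋯ ∧ s_r ∈ H⁰(L)` be the signed maximal minors; they span the image of
`d_E` (`range_detMap`).

*The evaluation sequence.* Cramer's rule gives `∑ λ(σᵢ) sᵢ = 0` for every local section `λ` of `L^*`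
(`sum_minor_smul`), so that `λ ↦ ∑ λ(σᵢ) ⊗ sᵢ` maps `L^*` to the kernel of `ev_E`. As `E` is
globally generated, near any point some `r` of the `sᵢ` form a basis of `E`
(`exists_isBasisOn_succAbove`). There the remaining minor generates `L`, and a relation between the
`sᵢ` is determined by a single coefficient (`relation_unique`). Hence `L^*` is the whole kernel
(`shortExact_minorInclusion`).

*The image of `γ`.* For an arbitrary `ι` with transpose `γ`, the sections `τᵢ = γ(sᵢ^*)` satisfy the
same relations as the `σᵢ`. Locally they are therefore a common multiple of the `σᵢ`; the factors
glue to a global function, which is a constant because `X` is projective and integral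
(`scalarHom_top_surjective`), and the constant is not zero because `ι ≠ 0`. So
the `τᵢ` and the `σᵢ` have the same span (`DualEvaluation.range_detMap_eq`).

*Injectivity.* A nonzero kernel element `∑ cᵢ s₀ ∧ ⋯ ŝᵢ ⋯ ∧ s_r` (with signs) of `d_E` is a linear
relation `∑ cᵢ σᵢ = 0`. It says that the linear form `sᵢ ↦ cᵢ` on `H⁰(E)`, as a map
`H⁰(E) ⊗ 𝒪_X ⟶ 𝒪_X`, vanishes on `L^*`, so it descends to a map `E ⟶ 𝒪_X` which takes the value `1`
at some global section. Thus `E ≅ F ⊕ 𝒪_X` with `det F ≅ det E` (`TrivialSummand`). Stability,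
applied to `𝒪_X`, makes the degree of `E` positive and, applied to `F`, gives
`deg E / (r - 1) < deg E / r`, a contradiction (`TrivialSummand.not_isMuStable`). Of the degree, this
uses only that it depends on the determinant alone and that it is zero for `𝒪_X`.
-/

namespace StableBundle

noncomputable section

/-! ### Local arguments for sections and local bases -/

section LocalBases

variable {X : Scheme.{0}}

lemma res_self (M : X.Modules) {U : X.Opens} (h : U ≤ U) (m : Γ(M, U)) : res M h m = m :=
  ConcreteCategory.congr_hom (M.presheaf.map_id (op U)) m

lemma resO_self {U : X.Opens} (h : U ≤ U) (a : Γ(X, U)) : resO X h a = a :=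
  ConcreteCategory.congr_hom (X.presheaf.map_id (op U)) a

lemma eq_of_locally_eq (M : X.Modules) {V : X.Opens} {m m' : Γ(M, V)}
    (h : ∀ x ∈ V, ∃ (W : X.Opens) (hW : W ≤ V), x ∈ W ∧ res M hW m = res M hW m') : m = m' := by
  choose W hW hx he using h
  refine TopCat.Sheaf.eq_of_locally_eq' ⟨M.presheaf, M.isSheaf⟩
    (fun x : V => W x.1 x.2) V (fun x => homOfLE (hW x.1 x.2)) ?_ m m' (fun x => he x.1 x.2)
  intro x hxV
  exact Opens.mem_iSup.mpr ⟨⟨x, hxV⟩, hx x hxV⟩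

lemma eq_of_locally_eqO {V : X.Opens} {a b : Γ(X, V)}
    (h : ∀ x ∈ V, ∃ (W : X.Opens) (hW : W ≤ V), x ∈ W ∧ resO X hW a = resO X hW b) : a = b :=
  eq_of_locally_eq (structureModule X) (m := a) (m' := b) h

/-- Functions given near each point of `V` glue if any two of them agree on every open set on
which both are defined. -/
lemma exists_glueO {V : X.Opens} (W : ∀ x ∈ V, X.Opens) (hW : ∀ x hx, W x hx ≤ V)
    (hmem : ∀ x hx, x ∈ W x hx) (s : ∀ x hx, Γ(X, W x hx))
    (hs : ∀ x hx y hy (T : X.Opens) (h₁ : T ≤ W x hx) (h₂ : T ≤ W y hy),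
      resO X h₁ (s x hx) = resO X h₂ (s y hy)) :
    ∃ t : Γ(X, V), ∀ x hx, resO X (hW x hx) t = s x hx := by
  obtain ⟨t, ht, -⟩ := existsUnique_glueO V (fun x : V => W x.1 x.2) (fun x => hW x.1 x.2)
    (fun x hxV => Opens.mem_iSup.mpr ⟨⟨x, hxV⟩, hmem x hxV⟩) (fun x => s x.1 x.2)
    (fun x y => hs _ _ _ _ _ _ _)
  exact ⟨t, fun x hx => ht ⟨x, hx⟩⟩

/-- Sections given near each point of `V` glue if any two of them agree on every open set on
which both are defined. -/
lemma exists_glue (M : X.Modules) {V : X.Opens} (W : ∀ x ∈ V, X.Opens) (hW : ∀ x hx, W x hx ≤ V)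
    (hmem : ∀ x hx, x ∈ W x hx) (s : ∀ x hx, Γ(M, W x hx))
    (hs : ∀ x hx y hy (T : X.Opens) (h₁ : T ≤ W x hx) (h₂ : T ≤ W y hy),
      res M h₁ (s x hx) = res M h₂ (s y hy)) :
    ∃ t : Γ(M, V), ∀ x hx, res M (hW x hx) t = s x hx := by
  obtain ⟨t, ht, -⟩ := TopCat.Sheaf.existsUnique_gluing' ⟨M.presheaf, M.isSheaf⟩
    (fun x : V => W x.1 x.2) V (fun x => homOfLE (hW x.1 x.2))
    (fun x hxV => Opens.mem_iSup.mpr ⟨⟨x, hxV⟩, hmem x hxV⟩) (fun x => s x.1 x.2)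
    (fun x y => hs _ _ _ _ _ _ _)
  exact ⟨t, fun x hx => ht ⟨x, hx⟩⟩

lemma res_sum_smul (M : X.Modules) {ι : Type} [Fintype ι] {U V : X.Opens} (h : V ≤ U)
    (a : ι → Γ(X, U)) (m : ι → Γ(M, U)) :
    res M h (∑ i, a i • m i) = ∑ i, resO X h (a i) • res M h (m i) := by
  rw [map_sum]
  exact Finset.sum_congr rfl fun i _ => res_smul M h _ _

lemma app_sum_smul {M N : X.Modules} (f : M ⟶ N) {ι : Type} [Fintype ι] {U : X.Opens}
    (a : ι → Γ(X, U)) (m : ι → Γ(M, U)) :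
    f.app U (∑ i, a i • m i) = ∑ i, a i • f.app U (m i) := by
  rw [map_sum]
  exact Finset.sum_congr rfl fun i _ => Scheme.Modules.Hom.app_smul f _ _

/-- A morphism of sheaves of modules from compatible linear maps on sections. -/
def homMk {M N : X.Modules} (φ : ∀ U : X.Opens, Γ(M, U) →ₗ[Γ(X, U)] Γ(N, U))
    (hφ : ∀ {U V : X.Opens} (h : V ≤ U) (m : Γ(M, U)), φ V (res M h m) = res N h (φ U m)) :
    M ⟶ N :=
  SheafOfModules.Hom.mk (R := X.ringCatSheaf) (PresheafOfModules.homMk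
    (M₁ := M.val) (M₂ := N.val)
    { app := fun U => AddCommGrpCat.ofHom (φ U.unop).toAddMonoidHom
      naturality := fun _ _ i => AddCommGrpCat.hom_ext (AddMonoidHom.ext fun m =>
        hφ (leOfHom i.unop) m) }
    (fun U a m => (φ U.unop).map_smul a m))

/-- The sections `e i ∈ M(U)` form a basis of `M|_U`: they restrict to an `𝒪(V)`-basis of `M(V)`
for every open `V ⊆ U`. -/
def IsBasisOn (M : X.Modules) (U : X.Opens) {ι : Type} [Fintype ι] (e : ι → Γ(M, U)) : Prop :=
  ∀ (V : X.Opens) (h : V ≤ U),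
    Function.Bijective fun a : ι → Γ(X, V) => ∑ i, a i • res M h (e i)

namespace IsBasisOn

variable {M : X.Modules} {U : X.Opens} {ι : Type} [Fintype ι] {e : ι → Γ(M, U)}

lemma res (he : IsBasisOn M U e) {V : X.Opens} (h : V ≤ U) :
    IsBasisOn M V (fun i => res M h (e i)) := by
  intro W k
  simpa only [res_res] using he W (k.trans h)

/-- The basis of the module `M(V)` given by a basis of `M|_U`, for `V ⊆ U`. -/
def basis (he : IsBasisOn M U e) {V : X.Opens} (h : V ≤ U) : Module.Basis ι Γ(X, V) Γ(M, V) :=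
  .ofEquivFun (LinearEquiv.ofBijective
    (Fintype.linearCombination Γ(X, V) fun i => StableBundle.res M h (e i))
    (he V h)).symm

lemma basis_apply (he : IsBasisOn M U e) {V : X.Opens} (h : V ≤ U) (i : ι) :
    he.basis h i = StableBundle.res M h (e i) := by
  classical
  rw [basis, Module.Basis.ofEquivFun]
  change Fintype.linearCombination Γ(X, V) (fun i => StableBundle.res M h (e i)) _ = _
  simp

lemma of_basis (h : ∀ (V : X.Opens) (h : V ≤ U), ∃ b : Module.Basis ι Γ(X, V) Γ(M, V),
    ∀ i, b i = StableBundle.res M h (e i)) : IsBasisOn M U e := by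
  intro V hV
  obtain ⟨b, hb⟩ := h V hV
  simp only [← hb]
  convert b.equivFun.symm.bijective using 1
  ext a
  rw [Module.Basis.equivFun_symm_apply]

lemma eq_zero (he : IsBasisOn M U e) {V : X.Opens} (h : V ≤ U) {a : ι → Γ(X, V)}
    (ha : ∑ i, a i • StableBundle.res M h (e i) = 0) : a = 0 :=
  (he V h).1 (by simpa using ha)

lemma exists_eq (he : IsBasisOn M U e) {V : X.Opens} (h : V ≤ U) (m : Γ(M, V)) :
    ∃ a : ι → Γ(X, V), m = ∑ i, a i • StableBundle.res M h (e i) := by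
  obtain ⟨a, ha⟩ := (he V h).2 m
  exact ⟨a, ha.symm⟩

/-- Linear independence may be combined with *local* generation, since coefficients glue. -/
lemma of_locally_generate
    (hinj : ∀ (V : X.Opens) (h : V ≤ U) (a : ι → Γ(X, V)),
      ∑ i, a i • StableBundle.res M h (e i) = 0 → a = 0)
    (hgen : ∀ (V : X.Opens) (h : V ≤ U) (m : Γ(M, V)), ∀ x ∈ V, ∃ (W : X.Opens) (hW : W ≤ V),
      x ∈ W ∧ ∃ a : ι → Γ(X, W),
        StableBundle.res M hW m = ∑ i, a i • StableBundle.res M (hW.trans h) (e i)) :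
    IsBasisOn M U e := by
  intro V h
  have inj (W : X.Opens) (hW : W ≤ U) : Function.Injective
      fun a : ι → Γ(X, W) => ∑ i, a i • StableBundle.res M hW (e i) := by
    intro a b hab
    refine sub_eq_zero.mp (hinj W hW _ ?_)
    simp only [Pi.sub_apply, sub_smul, Finset.sum_sub_distrib]
    exact sub_eq_zero.mpr hab
  refine ⟨inj V h, fun m => ?_⟩
  choose W hW hmem a ha using hgen V h m
  have glue (i : ι) := exists_glueO W hW hmem (fun x hx => a x hx i)
    (fun x hx y hy T h₁ h₂ => by
      refine congrFun (inj T (h₁.trans ((hW x hx).trans h)) ?_ :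
        (fun i => resO X h₁ (a x hx i)) = fun i => resO X h₂ (a y hy i)) i
      have e₁ := congrArg (StableBundle.res M h₁) (ha x hx)
      have e₂ := congrArg (StableBundle.res M h₂) (ha y hy)
      rw [res_res, res_sum_smul] at e₁ e₂
      simp only [res_res] at e₁ e₂
      exact e₁.symm.trans e₂)
  choose t ht using glue
  refine ⟨t, eq_of_locally_eq M fun x hx => ⟨W x hx, hW x hx, hmem x hx, ?_⟩⟩
  rw [res_sum_smul, ha]
  refine Finset.sum_congr rfl fun i _ => ?_
  rw [ht, res_res]

end IsBasisOn

/-! ### Morphisms that are locally bijective -/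

lemma app_injective_of_locally {M N : X.Modules} (f : M ⟶ N)
    (h : ∀ x : X, ∃ U : X.Opens, x ∈ U ∧ ∀ V ≤ U, Function.Injective (f.app V)) (V : X.Opens) :
    Function.Injective (f.app V) := by
  intro m m' hm
  refine eq_of_locally_eq M fun x hx => ?_
  obtain ⟨U, hxU, hU⟩ := h x
  refine ⟨V ⊓ U, inf_le_left, ⟨hx, hxU⟩, hU _ inf_le_right ?_⟩
  rw [← res_app, ← res_app, hm]

/-- For a morphism injective on sections, being in the image is a local condition. -/
lemma exists_app_eq_of_locally {M N : X.Modules} (f : M ⟶ N)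
    (hf : ∀ V, Function.Injective (f.app V)) {V : X.Opens} (n : Γ(N, V))
    (h : ∀ x ∈ V, ∃ (W : X.Opens) (hW : W ≤ V), x ∈ W ∧ ∃ m, f.app W m = res N hW n) :
    ∃ m, f.app V m = n := by
  choose W hW hmem m hm using h
  obtain ⟨t, ht⟩ := exists_glue M W hW hmem m (fun x hx y hy T h₁ h₂ => hf T (by
    rw [← res_app, ← res_app, hm, hm, res_res, res_res]))
  refine ⟨t, eq_of_locally_eq N fun x hx => ⟨W x hx, hW x hx, hmem x hx, ?_⟩⟩
  rw [res_app, ht, hm]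

lemma isIso_of_app_bijective {M N : X.Modules} (f : M ⟶ N)
    (h : ∀ V, Function.Bijective (f.app V)) : IsIso f :=
  Scheme.Modules.Hom.isIso_iff_isIso_app.mpr fun V =>
    (ConcreteCategory.isIso_iff_bijective (f.app V)).mpr (h V)

lemma app_bijective_of_isBasisOn {M N : X.Modules} (f : M ⟶ N) {U : X.Opens} {ι : Type}
    [Fintype ι] {e : ι → Γ(M, U)} (he : IsBasisOn M U e)
    (hfe : IsBasisOn N U fun i => f.app U (e i)) {V : X.Opens} (hV : V ≤ U) :
    Function.Bijective (f.app V) := by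
  have key : (f.app V) ∘ (fun a : ι → Γ(X, V) => ∑ i, a i • res M hV (e i)) =
      fun a : ι → Γ(X, V) => ∑ i, a i • res N hV (f.app U (e i)) := by
    funext a
    change f.app V (∑ i, a i • res M hV (e i)) = _
    rw [app_sum_smul]
    exact Finset.sum_congr rfl fun i _ => by rw [res_app]
  exact (Function.Bijective.of_comp_iff _ (he V hV)).mp (key ▸ hfe V hV)

/-- A morphism which near every point carries some basis to a basis is an isomorphism. -/
lemma isIso_of_locally_isBasisOn {M N : X.Modules} (f : M ⟶ N)
    (h : ∀ x : X, ∃ (U : X.Opens) (n : ℕ) (e : Fin n → Γ(M, U)), x ∈ U ∧ IsBasisOn M U e ∧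
      IsBasisOn N U fun i => f.app U (e i)) : IsIso f := by
  have bij (x : X) : ∃ U : X.Opens, x ∈ U ∧ ∀ V ≤ U, Function.Bijective (f.app V) := by
    obtain ⟨U, n, e, hx, he, hfe⟩ := h x
    exact ⟨U, hx, fun V hV => app_bijective_of_isBasisOn f he hfe hV⟩
  have inj := app_injective_of_locally f fun x => by
    obtain ⟨U, hx, hU⟩ := bij x
    exact ⟨U, hx, fun V hV => (hU V hV).1⟩
  refine isIso_of_app_bijective f fun V => ⟨inj V, fun n => ?_⟩
  refine exists_app_eq_of_locally f inj n fun x hx => ?_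
  obtain ⟨U, hxU, hU⟩ := bij x
  exact ⟨V ⊓ U, inf_le_left, ⟨hx, hxU⟩, (hU _ inf_le_right).2 _⟩

/-! ### Sheafification of locally free presheaves -/

instance presheafSectionsModule (P : X.PresheafOfModules) (U : X.Opens) :
    Module Γ(X, U) (P.presheaf.obj (op U)) := (P.obj (op U)).isModule

/-- The restriction map of a presheaf of modules. -/
def presheafRes (P : X.PresheafOfModules) {U V : X.Opens} (h : V ≤ U) :
    P.presheaf.obj (op U) →+ P.presheaf.obj (op V) := (P.presheaf.map (homOfLE h).op).hom

/-- The canonical map from the sections of a presheaf of modules to those of the associated sheaf,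
as a linear map. -/
def sheafifyLin (P : X.PresheafOfModules) (U : X.Opens) :
    P.presheaf.obj (op U) →ₗ[Γ(X, U)] Γ(sheafify P, U) where
  toFun := sheafifyUnit P U
  map_add' := map_add _
  map_smul' a p := sheafifyUnit_smul P U a p

lemma sheafifyLin_res (P : X.PresheafOfModules) {U V : X.Opens} (h : V ≤ U)
    (p : P.presheaf.obj (op U)) :
    sheafifyLin P V (presheafRes P h p) = res (sheafify P) h (sheafifyLin P U p) :=
  ConcreteCategory.congr_hom ((CategoryTheory.toSheafify (Opens.grothendieckTopology X)
    P.presheaf).naturality (homOfLE h).op) p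

lemma exists_presheafRes_eq (P : X.PresheafOfModules) {U : X.Opens} {p q : P.presheaf.obj (op U)}
    (h : sheafifyLin P U p = sheafifyLin P U q) (x : X) (hx : x ∈ U) :
    ∃ (V : X.Opens) (hV : V ≤ U), x ∈ V ∧ presheafRes P hV p = presheafRes P hV q := by
  obtain ⟨V, i, hi, hxV⟩ := Presheaf.equalizerSieve_mem (Opens.grothendieckTopology X)
    (CategoryTheory.toSheafify (Opens.grothendieckTopology X) P.presheaf) p q h x hx
  exact ⟨V, leOfHom i, hxV, hi⟩

lemma exists_sheafifyLin_eq (P : X.PresheafOfModules) {U : X.Opens} (m : Γ(sheafify P, U))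
    (x : X) (hx : x ∈ U) :
    ∃ (V : X.Opens) (hV : V ≤ U) (p : P.presheaf.obj (op V)), x ∈ V ∧
      sheafifyLin P V p = res (sheafify P) hV m := by
  obtain ⟨V, i, ⟨p, hp⟩, hxV⟩ := Presheaf.imageSieve_mem (Opens.grothendieckTopology X)
    (CategoryTheory.toSheafify (Opens.grothendieckTopology X) P.presheaf) (U := op U) m x hx
  exact ⟨V, leOfHom i, p, hxV, hp⟩

lemma presheafRes_sum_smul (P : X.PresheafOfModules) {ι : Type} [Fintype ι] {U V : X.Opens}
    (h : V ≤ U) (a : ι → Γ(X, U)) (p : ι → P.presheaf.obj (op U)) :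
    presheafRes P h (∑ i, a i • p i) = ∑ i, resO X h (a i) • presheafRes P h (p i) := by
  rw [map_sum]
  exact Finset.sum_congr rfl fun i _ => P.map_smul _ _ _

lemma presheafRes_presheafRes (P : X.PresheafOfModules) {U V W : X.Opens} (h : V ≤ U)
    (k : W ≤ V) (p : P.presheaf.obj (op U)) :
    presheafRes P k (presheafRes P h p) = presheafRes P (k.trans h) p := by
  have e : (homOfLE (k.trans h)).op = (homOfLE h).op ≫ (homOfLE k).op := rfl
  rw [presheafRes, presheafRes, presheafRes, e, Functor.map_comp]
  rfl

/-- If a presheaf of modules is free on `U`, so is the associated sheaf, with the same basis: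
a free presheaf is already a sheaf. -/
lemma IsBasisOn.sheafify {P : X.PresheafOfModules} {U : X.Opens} {ι : Type} [Fintype ι]
    {e : ι → P.presheaf.obj (op U)}
    (he : ∀ (V : X.Opens) (h : V ≤ U),
      Function.Bijective fun a : ι → Γ(X, V) => ∑ i, a i • presheafRes P h (e i)) :
    IsBasisOn (sheafify P) U fun i => sheafifyLin P U (e i) := by
  refine IsBasisOn.of_locally_generate (fun V h a ha => ?_) (fun V h m x hx => ?_)
  · simp only [← sheafifyLin_res, ← map_smul, ← map_sum] at ha
    rw [← map_zero (sheafifyLin P V)] at ha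
    funext i
    refine eq_of_locally_eqO fun x hx => ?_
    obtain ⟨W, hW, hxW, hz⟩ := exists_presheafRes_eq P ha x hx
    refine ⟨W, hW, hxW, ?_⟩
    replace hz := (presheafRes_sum_smul P hW _ _).symm.trans hz
    simp only [presheafRes_presheafRes] at hz
    have := congrFun ((he W (hW.trans h)).1 (a₁ := fun i => resO X hW (a i)) (a₂ := 0)
      (hz.trans ((map_zero (presheafRes P hW)).trans
        (Finset.sum_eq_zero fun i _ => zero_smul Γ(X, W) _).symm))) i
    rw [this, Pi.zero_apply, Pi.zero_apply, map_zero]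
  · obtain ⟨W, hW, p, hxW, hp⟩ := exists_sheafifyLin_eq P m x hx
    obtain ⟨a, ha⟩ := (he W (hW.trans h)).2 p
    refine ⟨W, hW, hxW, a, ?_⟩
    rw [← hp, ← ha]
    simp only [← sheafifyLin_res, ← map_smul, ← map_sum]

end LocalBases

/-! ### Alternating maps of top and next-to-top degree -/

section Alternating

variable {R : Type*} [CommRing R] {M N : Type*} [AddCommGroup M] [Module R M] [AddCommGroup N]
  [Module R N] {n : ℕ}

lemma alternatingMap_apply_eq_det_smul (b : Module.Basis (Fin n) R M) (f : M [⋀^Fin n]→ₗ[R] N)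
    (m : Fin n → M) : f m = b.det m • f b := by
  have : f = (LinearMap.toSpanSingleton R N (f b)).compAlternatingMap b.det := by
    refine Module.Basis.ext_alternating b fun v hv => ?_
    let σ : Equiv.Perm (Fin n) := Equiv.ofBijective v (Finite.injective_iff_bijective.1 hv)
    change f (b ∘ σ) = (LinearMap.toSpanSingleton R N (f b)).compAlternatingMap b.det (b ∘ σ)
    rw [AlternatingMap.map_perm, AlternatingMap.map_perm]
    simp [Module.Basis.det_self]
  exact congrArg (fun g : M [⋀^Fin n]→ₗ[R] N => g m) this

/-- The syzygy between `n + 1` elements of a free module of rank `n` given by their maximal minors: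
it is the Laplace expansion of a determinant with a repeated row. -/
lemma sum_alternatingMap_succAbove_smul (b : Module.Basis (Fin n) R M) (f : M [⋀^Fin n]→ₗ[R] R)
    (s : Fin (n + 1) → M) :
    ∑ i : Fin (n + 1), ((-1) ^ (i : ℕ) * f (fun j => s (i.succAbove j))) • s i = 0 := by
  refine b.ext_elem fun k => ?_
  let A : Matrix (Fin (n + 1)) (Fin (n + 1)) R :=
    Matrix.of (Fin.cons (fun i => b.repr (s i) k) (fun l i => b.repr (s i) l))
  have hA : A.det = 0 := by
    refine Matrix.det_zero_of_row_eq (i := 0) (j := k.succ) (Fin.succ_ne_zero k).symm ?_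
    funext i
    simp [A]
  rw [Matrix.det_succ_row_zero] at hA
  rw [map_sum, Finsupp.finsetSum_apply, map_zero, Finsupp.zero_apply,
    ← mul_zero (f b), ← hA, Finset.mul_sum]
  refine Finset.sum_congr rfl fun i _ => ?_
  have hdet : (A.submatrix Fin.succ i.succAbove).det = b.det fun j => s (i.succAbove j) := by
    rw [Module.Basis.det_apply]
    rfl
  have hA0 : A 0 i = b.repr (s i) k := rfl
  rw [alternatingMap_apply_eq_det_smul b f, hdet, hA0, map_smul, Finsupp.smul_apply, smul_eq_mul,
    smul_eq_mul]
  ring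

lemma bijective_smul_ιMulti (b : Module.Basis (Fin n) R M) :
    Function.Bijective fun a : R => a • exteriorPower.ιMulti R n b := by
  let d : ⋀[R]^n M →ₗ[R] R := exteriorPower.alternatingMapLinearEquiv b.det
  have hd : d (exteriorPower.ιMulti R n b) = 1 :=
    (exteriorPower.alternatingMapLinearEquiv_apply_ιMulti _ _).trans b.det_self
  refine ⟨fun a a' h => ?_, fun ω => ?_⟩
  · simpa [hd] using congrArg d h
  · have hω : ω ∈ Submodule.span R (Set.range (exteriorPower.ιMulti R n (M := M))) := by
      rw [exteriorPower.ιMulti_span]; trivial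
    induction hω using Submodule.span_induction with
    | mem _ h =>
      obtain ⟨m, rfl⟩ := h
      exact ⟨b.det m, (alternatingMap_apply_eq_det_smul b (exteriorPower.ιMulti R n) m).symm⟩
    | zero => exact ⟨0, zero_smul _ _⟩
    | add _ _ _ _ h₁ h₂ =>
      obtain ⟨a₁, rfl⟩ := h₁
      obtain ⟨a₂, rfl⟩ := h₂
      exact ⟨a₁ + a₂, add_smul _ _ _⟩
    | smul c _ _ h =>
      obtain ⟨a, rfl⟩ := h
      exact ⟨c * a, mul_smul _ _ _⟩

/-- If `s₀, …, sₙ` generate `M`, then the products of `n` of them, in increasing order, generate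
`⋀ⁿ M`. -/
lemma span_ιMulti_succAbove {s : Fin (n + 1) → M}
    (hs : Submodule.span R (Set.range s) = ⊤) :
    Submodule.span R (Set.range fun i : Fin (n + 1) =>
      exteriorPower.ιMulti R n fun j => s (i.succAbove j)) = ⊤ := by
  rw [eq_top_iff, ← exteriorPower.ιMulti_span_of_span R n M hs, Submodule.span_le]
  rintro _ ⟨m, hm, rfl⟩
  have hm' : ∀ j, ∃ i, s i = m j := fun j => hm ⟨j, rfl⟩
  choose g hg using hm'
  obtain rfl : m = fun j => s (g j) := funext fun j => (hg j).symm
  by_cases hinj : Function.Injective g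
  · obtain ⟨i, hi⟩ : ∃ i, i ∉ Set.range g := by
      by_contra! h
      have := Fintype.card_le_of_surjective g h
      simp at this
    have hne : ∀ j, ∃ l, i.succAbove l = g j := fun j =>
      Fin.exists_succAbove_eq fun h => hi ⟨j, h⟩
    choose τ hτ using hne
    have hτinj : Function.Injective τ := fun j j' h => hinj (by rw [← hτ, ← hτ, h])
    let σ : Equiv.Perm (Fin n) := Equiv.ofBijective τ (Finite.injective_iff_bijective.1 hτinj)
    have : (fun j => s (g j)) = (fun j => s (i.succAbove j)) ∘ σ := by
      funext j
      exact congrArg s (hτ j).symm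
    rw [this, AlternatingMap.map_perm]
    exact Submodule.smul_of_tower_mem _ _ (Submodule.subset_span ⟨i, rfl⟩)
  · rw [AlternatingMap.map_eq_zero_of_not_injective _ _ fun h => hinj fun a b hab => h (by
      simp only [hab])]
    exact Submodule.zero_mem _

/-- If `n + 1` elements generate a free module of rank `n`, their maximal minors generate the unit
ideal. -/
lemma exists_sum_det_succAbove_eq_one (b : Module.Basis (Fin n) R M) {s : Fin (n + 1) → M}
    (hs : Submodule.span R (Set.range s) = ⊤) :
    ∃ c : Fin (n + 1) → R, ∑ i, c i * b.det (fun j => s (i.succAbove j)) = 1 := by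
  have hb : exteriorPower.ιMulti R n b ∈ Submodule.span R (Set.range fun i : Fin (n + 1) =>
      exteriorPower.ιMulti R n fun j => s (i.succAbove j)) := by
    rw [span_ιMulti_succAbove hs]; trivial
  obtain ⟨c, hc⟩ := (Submodule.mem_span_range_iff_exists_fun R).mp hb
  refine ⟨c, ?_⟩
  have := congrArg (exteriorPower.alternatingMapLinearEquiv b.det) hc
  simpa [exteriorPower.alternatingMapLinearEquiv_apply_ιMulti, b.det_self] using this

end Alternating

/-! ### Local bases of exterior powers, of the structure sheaf and of duals -/

section Bases

variable {X : Scheme.{0}}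

lemma exists_isUnit_res {U : X.Opens} (a : Γ(X, U)) (x : X) (hx : x ∈ U)
    (h : IsUnit (X.presheaf.germ U x hx a)) :
    ∃ (V : X.Opens) (hV : V ≤ U), x ∈ V ∧ IsUnit (resO X hV a) := by
  obtain ⟨V, i, hxV, hu⟩ := RingedSpace.isUnit_res_of_isUnit_germ _ U a x hx h
  exact ⟨V, leOfHom i, hxV, hu⟩

/-- If a finite sum of functions is `1`, then near any given point one of them is invertible: the
local rings of `X` are local. -/
lemma exists_isUnit_res_of_sum_eq_one {U : X.Opens} {ι : Type} [Fintype ι] (a : ι → Γ(X, U))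
    (ha : ∑ i, a i = 1) (x : X) (hx : x ∈ U) :
    ∃ (i : ι) (V : X.Opens) (hV : V ≤ U), x ∈ V ∧ IsUnit (resO X hV (a i)) := by
  have h := congrArg (X.presheaf.germ U x hx) ha
  rw [map_sum, map_one] at h
  obtain ⟨i, -, hi⟩ := IsLocalRing.exists_of_isUnit_sum (h ▸ isUnit_one)
  obtain ⟨V, hV, hxV, hu⟩ := exists_isUnit_res (a i) x hx hi
  exact ⟨i, V, hV, hxV, hu⟩

lemma toExtPow_res (n : ℕ) (M : X.Modules) {U V : X.Opens} (h : V ≤ U)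
    (m : Fin n → Γ(M, U)) :
    res (extPow n M) h (toExtPow n M U (exteriorPower.ιMulti Γ(X, U) n m)) =
      toExtPow n M V (exteriorPower.ιMulti Γ(X, V) n fun i => res M h (m i)) := by
  refine (sheafifyLin_res (exteriorPresheaf M n) h _).symm.trans ?_
  exact congrArg (toExtPow n M V) (exteriorMapSL_ιMulti _ (resSL M (homOfLE h)) n m)

/-- A basis `e₁, …, eₙ` of `M|_U` gives the generator `e₁ ∧ ⋯ ∧ eₙ` of `(⋀ⁿ M)|_U`. -/
lemma IsBasisOn.extPow {M : X.Modules} {U : X.Opens} {n : ℕ} {e : Fin n → Γ(M, U)}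
    (he : IsBasisOn M U e) :
    IsBasisOn (extPow n M) U fun _ : Fin 1 =>
      toExtPow n M U (exteriorPower.ιMulti Γ(X, U) n e) := by
  refine IsBasisOn.sheafify (P := exteriorPresheaf M n)
    (e := fun _ => exteriorPower.ιMulti Γ(X, U) n e) fun V h => ?_
  have h₁ : presheafRes (exteriorPresheaf M n) h (exteriorPower.ιMulti Γ(X, U) n e) =
      exteriorPower.ιMulti Γ(X, V) n (he.basis h) := by
    refine (exteriorMapSL_ιMulti _ (resSL M (homOfLE h)) n e).trans ?_
    congr 1
    funext i
    exact (he.basis_apply h i).symm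
  have h₂ := (bijective_smul_ιMulti (he.basis h)).comp
    (Equiv.funUnique (Fin 1) Γ(X, V)).bijective
  refine (congrArg Function.Bijective (funext fun a => ?_)).mpr h₂
  exact (Fintype.sum_unique _).trans (congrArg (a 0 • ·) h₁)

lemma isBasisOn_structureModule :
    IsBasisOn (structureModule X) ⊤ fun _ : Fin 1 => (1 : Γ(X, ⊤)) := by
  intro V h
  refine (congrArg Function.Bijective (funext fun a => ?_)).mpr
    (Equiv.funUnique (Fin 1) Γ(X, V)).bijective
  refine (Fintype.sum_unique _).trans ?_
  change a 0 * resO X h 1 = a 0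
  rw [map_one, mul_one]

/-- The morphism `𝒪_X ⟶ M` given by a global section of `M`. -/
def sectionHom {M : X.Modules} (m : Γ(M, ⊤)) : structureModule X ⟶ M :=
  homMk (M := structureModule X)
    (fun U => LinearMap.toSpanSingleton Γ(X, U) Γ(M, U) (res M le_top m))
    (fun {U V} h a => by
      refine Eq.trans ?_ (res_smul M h a (res M le_top m)).symm
      rw [res_res]
      rfl)

lemma sectionHom_app {M : X.Modules} (m : Γ(M, ⊤)) (U : X.Opens) (a : Γ(X, U)) :
    (sectionHom m).app U a = a • res M le_top m := rfl

lemma IsBasisOn.nonempty_iso_structureModule {M : X.Modules} {e : Fin 1 → Γ(M, ⊤)}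
    (he : IsBasisOn M ⊤ e) : Nonempty (structureModule X ≅ M) := by
  have : IsIso (sectionHom (e 0)) := by
    refine isIso_of_locally_isBasisOn _ fun x => ⟨⊤, 1, _, trivial, isBasisOn_structureModule, ?_⟩
    convert he using 1
    funext i
    rw [sectionHom_app, one_smul, res_self, Subsingleton.elim i 0]
  exact ⟨asIso (sectionHom (e 0))⟩

/-- The linear form on `M|_U` dual to a generator. -/
def IsBasisOn.coord {M : X.Modules} {U : X.Opens} {e : Fin 1 → Γ(M, U)} (he : IsBasisOn M U e) :
    DualSection M U where
  toFun V h := (he.basis h).coord 0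
  compat V W hV h m := by
    obtain ⟨a, rfl⟩ := he.exists_eq hV m
    have key (T : X.Opens) (hT : T ≤ U) (c : Fin 1 → Γ(X, T)) :
        (he.basis hT).coord 0 (∑ i, c i • StableBundle.res M hT (e i)) = c 0 := by
      simp_rw [← he.basis_apply hT]
      rw [Fintype.sum_unique, map_smul, Module.Basis.coord_apply, Fin.default_eq_zero,
        Module.Basis.repr_self, Finsupp.single_eq_same, smul_eq_mul, mul_one]
    rw [key, res_sum_smul]
    simp only [res_res]
    rw [key W (h.trans hV) fun i => resO X h (a i)]

lemma IsBasisOn.coord_apply {M : X.Modules} {U : X.Opens} {e : Fin 1 → Γ(M, U)}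
    (he : IsBasisOn M U e) {V : X.Opens} (h : V ≤ U) :
    he.coord.toFun V h (StableBundle.res M h (e 0)) = 1 := by
  rw [← he.basis_apply h]
  exact (he.basis h).coord_apply 0 _ |>.trans (by
    rw [Module.Basis.repr_self, Finsupp.single_eq_same])

/-- Near a generator of a line bundle, a linear form is determined by its value on it. -/
lemma DualSection.ext_of_isBasisOn {M : X.Modules} {U : X.Opens} {e : Fin 1 → Γ(M, U)}
    (he : IsBasisOn M U e) {V : X.Opens} (h : V ≤ U) {φ ψ : DualSection M V}
    (hφ : φ.toFun V le_rfl (res M h (e 0)) = ψ.toFun V le_rfl (res M h (e 0))) : φ = ψ := by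
  apply DualSection.ext
  funext W k
  ext m
  obtain ⟨a, rfl⟩ := he.exists_eq (k.trans h) m
  rw [Fintype.sum_unique, map_smul, map_smul, ← res_res M h k]
  congr 1
  exact (φ.compat V W le_rfl k _).symm.trans ((congrArg (resO X k) hφ).trans
    (ψ.compat V W le_rfl k _))

lemma IsBasisOn.dual {M : X.Modules} {U : X.Opens} {e : Fin 1 → Γ(M, U)}
    (he : IsBasisOn M U e) : IsBasisOn (dual M) U fun _ : Fin 1 => (he.coord : DualSection M U) := by
  intro V h
  have key (a : Fin 1 → Γ(X, V)) : (∑ i, a i • StableBundle.res (StableBundle.dual M) h he.coord :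
      DualSection M V) = a 0 • DualSection.restrict h he.coord := Fintype.sum_unique _
  have val (c : Γ(X, V)) : (c • DualSection.restrict h he.coord).toFun V le_rfl
      (StableBundle.res M h (e 0)) = c := by
    rw [DualSection.smul_toFun, resO_self, LinearMap.smul_apply]
    exact (congrArg (c • ·) (he.coord_apply h)).trans (mul_one c)
  refine ⟨fun a b hab => ?_, fun φ => ?_⟩
  · funext i
    rw [Subsingleton.elim i 0, ← val (a 0), ← val (b 0), ← key, ← key]
    exact congrArg (fun φ : DualSection M V => φ.toFun V le_rfl (StableBundle.res M h (e 0))) hab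
  · refine ⟨fun _ => (show DualSection M V from φ).toFun V le_rfl (StableBundle.res M h (e 0)), ?_⟩
    refine (key _).trans (DualSection.ext_of_isBasisOn he h ?_)
    rw [val]

end Bases

/-! ### Trivial bundles -/

section Triv

variable {X : Scheme.{0}} [X.Over (Spec (CommRingCat.of ℂ))]

/-- A vector `w ∈ W` as a constant section of `W ⊗ 𝒪_X`. -/
def constVec {W : Type} [AddCommGroup W] [Module ℂ W] (w : W) : Γ(triv X W, ⊤) :=
  sheafifyLin (trivPresheaf X W) ⊤ ((1 : Γ(X, ⊤)) ⊗ₜ[ℂ] w)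

variable {W : Type} [AddCommGroup W] [Module ℂ W]

lemma res_constVec (w : W) (U : X.Opens) :
    res (triv X W) le_top (constVec w) =
      sheafifyLin (trivPresheaf X W) U ((1 : Γ(X, U)) ⊗ₜ[ℂ] w) := by
  refine (sheafifyLin_res (trivPresheaf X W) le_top _).symm.trans ?_
  refine congrArg (sheafifyLin (trivPresheaf X W) U) ?_
  change (resC (homOfLE le_top)).rTensor W ((1 : Γ(X, ⊤)) ⊗ₜ[ℂ] w) = _
  rw [LinearMap.rTensor_tmul]
  exact congrArg (· ⊗ₜ[ℂ] w) (map_one (resO X le_top))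

lemma trivDesc_app_constVec {M : X.Modules} (φ : W →ₗ[ℂ] Γ(M, ⊤)) (U : X.Opens) (w : W) :
    (trivDesc φ).app U (res (triv X W) le_top (constVec w)) = res M le_top (φ w) := by
  rw [res_constVec]
  refine (trivDesc_unit φ U _).trans ?_
  rw [trivDescApp, LinearMap.liftBaseChange_tmul, one_smul]
  rfl

lemma trivDesc_app_top_constVec {M : X.Modules} (φ : W →ₗ[ℂ] Γ(M, ⊤)) (w : W) :
    (trivDesc φ).app ⊤ (constVec w) = φ w := by
  have := trivDesc_app_constVec φ ⊤ w
  rwa [res_self, res_self] at this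

/-- A basis of `W` is a basis of `W ⊗ 𝒪_X` on all of `X`. -/
lemma isBasisOn_triv {ι : Type} [Fintype ι] (b : Module.Basis ι ℂ W) :
    IsBasisOn (triv X W) ⊤ fun i => constVec (b i) := by
  refine IsBasisOn.sheafify (P := trivPresheaf X W)
    (e := fun i => (1 : Γ(X, ⊤)) ⊗ₜ[ℂ] b i) fun V h => ?_
  refine (congrArg Function.Bijective (funext fun a => ?_)).mpr
    (Algebra.TensorProduct.basis Γ(X, V) b).equivFun.symm.bijective
  rw [Module.Basis.equivFun_symm_apply]
  refine Finset.sum_congr rfl fun i _ => congrArg (a i • ·) ?_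
  rw [Algebra.TensorProduct.basis_apply]
  change (resC (homOfLE h)).rTensor W ((1 : Γ(X, ⊤)) ⊗ₜ[ℂ] b i) = _
  rw [LinearMap.rTensor_tmul]
  exact congrArg (· ⊗ₜ[ℂ] b i) (map_one (resO X le_top))

lemma triv_hom_ext {ι : Type} [Fintype ι] (b : Module.Basis ι ℂ W) {M : X.Modules}
    {f g : triv X W ⟶ M}
    (h : ∀ i, f.app ⊤ (constVec (b i)) = g.app ⊤ (constVec (b i))) : f = g := by
  ext U m
  obtain ⟨a, rfl⟩ := (isBasisOn_triv b).exists_eq le_top m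
  rw [app_sum_smul, app_sum_smul]
  refine Finset.sum_congr rfl fun i _ => ?_
  rw [← res_app, ← res_app, h]

end Triv

/-! ### Epimorphisms of sheaves of modules -/

section Epi

variable {X : Scheme.{0}}

/-- An epimorphism of sheaves of modules is locally surjective: its composite with the map to the
sheaf associated with the presheaf cokernel vanishes. -/
lemma exists_app_eq_of_epi {M N : X.Modules} (f : M ⟶ N) [Epi f] {U : X.Opens} (n : Γ(N, U))
    (x : X) (hx : x ∈ U) :
    ∃ (V : X.Opens) (hV : V ≤ U), x ∈ V ∧ ∃ m, f.app V m = res N hV n := by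
  let g : M.val ⟶ N.val := (Scheme.Modules.toPresheafOfModules X).map f
  let q : N.val ⟶ Limits.cokernel g := Limits.cokernel.π g
  let u : N ⟶ sheafify (Limits.cokernel g) := SheafOfModules.Hom.mk (R := X.ringCatSheaf)
    (q ≫ (PresheafOfModules.sheafificationAdjunction (𝟙 X.ringCatSheaf.obj)).unit.app _)
  have hu : u = 0 := by
    rw [← cancel_epi f, Limits.comp_zero]
    apply (Scheme.Modules.toPresheafOfModules X).map_injective
    change g ≫ q ≫ _ = 0
    exact (Category.assoc _ _ _).symm.trans
      ((congrArg (· ≫ _) (Limits.cokernel.condition g)).trans Limits.zero_comp)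
  have hn : sheafifyLin (Limits.cokernel g) U (q.app (op U) n) =
      sheafifyLin (Limits.cokernel g) U 0 := by
    rw [map_zero]
    exact congrArg (fun v : N ⟶ _ => v.app U n) hu
  obtain ⟨V, hV, hxV, h⟩ := exists_presheafRes_eq _ hn x hx
  refine ⟨V, hV, hxV, ?_⟩
  have hq : q.app (op V) (res N hV n) = 0 := by
    refine Eq.trans ?_ (h.trans (map_zero _))
    exact (ConcreteCategory.congr_hom
      (((PresheafOfModules.toPresheaf _).map q).naturality (homOfLE hV).op) n)
  have hex := (ShortComplex.exact_cokernel g).map (PresheafOfModules.evaluation _ (op V))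
  rw [ShortComplex.moduleCat_exact_iff] at hex
  exact hex (res N hV n) hq

end Epi

/-! ### Vector bundles are coherent -/

section Free

universe u v₁ u₁

variable {A : Type*} [Ring A] {M : Type*} [AddCommGroup M] [Module A M] {I : Type*} [Fintype I]

/-- Linear combinations of a finite family, over a ring that need not be commutative. -/
def combination (v : I → M) : (I → A) →ₗ[A] M := ∑ i, (LinearMap.proj i).smulRight (v i)

lemma combination_apply (v : I → M) (a : I → A) : combination v a = ∑ i, a i • v i := by
  simp [combination]

lemma combination_single [DecidableEq I] (v : I → M) (i : I) :
    combination (A := A) v (Pi.single i 1) = v i := by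
  rw [combination_apply, Finset.sum_eq_single i (fun j _ hj => by
    rw [Pi.single_eq_of_ne hj, zero_smul]) (fun h => absurd (Finset.mem_univ i) h),
    Pi.single_eq_same, one_smul]

variable {C : Type u₁} [Category.{v₁} C] {J : GrothendieckTopology C} {R : Sheaf J RingCat.{u}}

lemma map_combination (N : PresheafOfModules.{u} R.obj) {I : Type u} [Fintype I]
    (s : I → N.sections) {V W : Cᵒᵖ} (f : V ⟶ W) (a : I → R.obj.obj V) :
    N.map f (combination (fun i => (s i).eval V) a) =
      combination (fun i => (s i).eval W) (fun i => R.obj.map f (a i)) := by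
  rw [combination_apply, combination_apply]
  refine (map_sum (N.map f).hom _ _).trans (Finset.sum_congr rfl fun i _ => ?_)
  refine (N.map_smul f _ _).trans ?_
  exact congrArg (R.obj.map f (a i) • ·) (PresheafOfModules.sections_property (s i) f)

/-- If sections of a sheaf of modules form a basis on every object, they identify it with a free
sheaf. -/
lemma isIso_freeHomEquiv_symm [HasWeakSheafify J AddCommGrpCat.{u}]
    [J.WEqualsLocallyBijective AddCommGrpCat.{u}] (N : SheafOfModules.{u} R) {I : Type u} [Fintype I]
    (s : I → N.sections)
    (hs : ∀ V : Cᵒᵖ, Function.Bijective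
      (combination (A := R.obj.obj V) (M := N.val.obj V) fun i => (s i).eval V)) :
    IsIso (N.freeHomEquiv.symm s) := by
  let E (V : Cᵒᵖ) := LinearEquiv.ofBijective _ (hs V)
  let t (V : Cᵒᵖ) : (I → R.obj.obj V) →ₗ[R.obj.obj V] (SheafOfModules.free (R := R) I).val.obj V :=
    combination fun i => (SheafOfModules.freeSection (R := R) i).eval V
  let h : N ⟶ SheafOfModules.free I := SheafOfModules.Hom.mk
    { app := fun V => ModuleCat.ofHom ((t V).comp (E V).symm.toLinearMap)
      naturality := fun {V W} f => by
        ext m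
        obtain ⟨a, rfl⟩ := (E V).surjective m
        change t W ((E W).symm (N.val.map f (E V a))) =
          (SheafOfModules.free (R := R) I).val.map f (t V ((E V).symm (E V a)))
        rw [LinearEquiv.symm_apply_apply]
        have h₁ : N.val.map f (E V a) = E W fun i => R.obj.map f (a i) :=
          map_combination N.val s f a
        rw [h₁, LinearEquiv.symm_apply_apply]
        exact (map_combination (SheafOfModules.free (R := R) I).val
          (fun i => SheafOfModules.freeSection i) f a).symm }
  have key (V : Cᵒᵖ) (i : I) : (N.freeHomEquiv.symm s).val.app V
      ((SheafOfModules.freeSection (R := R) i).eval V) = (s i).eval V :=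
    congrArg (fun x : N.sections => x.eval V)
      (SheafOfModules.sectionsMap_freeHomEquiv_symm_freeSection s i)
  have key' (V : Cᵒᵖ) (a : I → R.obj.obj V) :
      (N.freeHomEquiv.symm s).val.app V (t V a) = E V a := by
    refine (congrArg _ (combination_apply _ _)).trans ?_
    refine (map_sum ((N.freeHomEquiv.symm s).val.app V).hom _ _).trans ?_
    refine Eq.trans ?_ (combination_apply _ _).symm
    refine Finset.sum_congr rfl fun i _ => ?_
    exact (map_smul ((N.freeHomEquiv.symm s).val.app V).hom _ _).trans
      (congrArg (a i • ·) (key V i))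
  classical
  have hE (V : Cᵒᵖ) (i : I) : (E V).symm ((s i).eval V) = Pi.single i 1 :=
    (LinearEquiv.symm_apply_eq _).mpr (combination_single (fun i => (s i).eval V) i).symm
  refine ⟨h, ?_, ?_⟩
  · apply (SheafOfModules.freeHomEquiv _).injective
    funext i
    refine PresheafOfModules.sections_ext _ _ fun V => ?_
    change t V ((E V).symm ((N.freeHomEquiv.symm s).val.app V
      ((SheafOfModules.freeSection (R := R) i).eval V))) =
      (SheafOfModules.freeSection (R := R) i).eval V
    rw [key, hE]
    exact combination_single _ i
  · apply SheafOfModules.hom_ext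
    ext V m
    obtain ⟨a, rfl⟩ := (E V).surjective m
    change (N.freeHomEquiv.symm s).val.app V (t V ((E V).symm (E V a))) = E V a
    rw [LinearEquiv.symm_apply_apply, key']

end Free

section Coherent

variable {X : Scheme.{0}}

/-- A section of `M` over `U` as a global section of the restriction of `M` to `U`. -/
def overSection {M : X.Modules} {U : X.Opens} (e : Γ(M, U)) :
    (SheafOfModules.over (R := X.ringCatSheaf) M U).sections :=
  PresheafOfModules.sectionsMk (fun V => res M (leOfHom V.unop.hom) e)
    (fun V _ f => res_res M (leOfHom V.unop.hom) (leOfHom f.unop.left) e)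

/-- The local bases provide local presentations without relations. -/
lemma IsVectorBundle.isCoherent {r : ℕ} {M : X.Modules} (hM : IsVectorBundle r M) :
    IsCoherent M := by
  choose U hxU e he using hM
  have iso (x : X) : IsIso ((SheafOfModules.over (R := X.ringCatSheaf) M (U x)).freeHomEquiv.symm
      fun i => overSection (e x i)) := by
    refine isIso_freeHomEquiv_symm _ _ fun V => ?_
    refine (congrArg Function.Bijective (funext fun a => ?_)).mpr
      (he x V.unop.left (leOfHom V.unop.hom))
    exact combination_apply _ _
  let q : SheafOfModules.LocalGeneratorsData (R := X.ringCatSheaf) M :=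
    { I := X
      X := U
      coversTop := fun V x hx => ⟨V ⊓ U x, homOfLE inf_le_left, ⟨x, ⟨homOfLE inf_le_right⟩⟩,
        ⟨hx, hxU x⟩⟩
      generators := fun x =>
        { I := Fin r
          s := fun i => overSection (e x i)
          epi := by
            have := iso x
            infer_instance } }
  have hq : q.IsLocallyFreeData := ⟨iso⟩
  refine ⟨q.quasiCoherentData, ⟨fun x => ⟨⟨?_⟩, ⟨?_⟩⟩⟩⟩
  · exact inferInstanceAs (Finite (Fin r))
  · exact inferInstanceAs (Finite (ULift Empty))

end Coherent

/-! ### Global functions on a projective variety -/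

section GlobalFunctions

attribute [local instance] MvPolynomial.gradedAlgebra

/-- `Proj` is proper over the degree `0` part, which for a polynomial ring over `ℂ` is `ℂ`. -/
lemma universallyClosed_projectiveSpaceStr (N : ℕ) : UniversallyClosed (projectiveSpaceStr N) := by
  let 𝒜 := MvPolynomial.homogeneousSubmodule (Fin (N + 1)) ℂ
  have htower : IsScalarTower ℂ (𝒜 0) (MvPolynomial (Fin (N + 1)) ℂ) :=
    ⟨fun c a p => smul_mul_assoc c (a : MvPolynomial (Fin (N + 1)) ℂ) p⟩
  have hft : Algebra.FiniteType (𝒜 0) (MvPolynomial (Fin (N + 1)) ℂ) :=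
    Algebra.FiniteType.of_restrictScalars_finiteType ℂ _ _
  have hbij : Function.Bijective (algebraMap ℂ (𝒜 0)) := by
    refine ⟨fun c d h => MvPolynomial.C_injective (Fin (N + 1)) ℂ
      (congrArg Subtype.val h), fun p => ?_⟩
    have hp : (p : MvPolynomial (Fin (N + 1)) ℂ).IsHomogeneous 0 := p.2
    rw [← MvPolynomial.totalDegree_zero_iff_isHomogeneous,
      MvPolynomial.totalDegree_eq_zero_iff_eq_C] at hp
    exact ⟨_, Subtype.ext hp.symm⟩
  have hiso : IsIso (CommRingCat.ofHom (algebraMap ℂ (𝒜 0))) :=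
    (ConcreteCategory.isIso_iff_bijective _).mpr hbij
  have h₁ : UniversallyClosed (Proj.toSpecZero 𝒜) := inferInstance
  have h₂ : IsIso (Spec.map (CommRingCat.ofHom (algebraMap ℂ (𝒜 0)))) := inferInstance
  exact inferInstanceAs (UniversallyClosed (Proj.toSpecZero 𝒜 ≫
    Spec.map (CommRingCat.ofHom (algebraMap ℂ (𝒜 0)))))

/-- Global functions on a projective variety over `ℂ` are constant: they form a domain which is
integral over `ℂ`. -/
lemma scalarHom_top_surjective {X : Scheme.{0}} [X.Over (Spec (CommRingCat.of ℂ))] [IsIntegral X]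
    (hproj : IsProjective X) : Function.Surjective (scalarHom X ⊤) := by
  obtain ⟨N, i, hi, hs⟩ := hproj
  have := universallyClosed_projectiveSpaceStr N
  have huc : UniversallyClosed (X ↘ Spec (CommRingCat.of ℂ)) := by
    rw [← hs]
    infer_instance
  have hint : (scalarHom X ⊤).IsIntegral := by
    have h₁ : scalarHom X ⊤ = ((Scheme.ΓSpecIso (CommRingCat.of ℂ)).inv ≫
        (X ↘ Spec (CommRingCat.of ℂ)).appTop).hom := by
      have : (homOfLE (le_top : (⊤ : X.Opens) ≤ ⊤)).op = 𝟙 _ := rfl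
      rw [scalarHom, this, X.presheaf.map_id, Category.comp_id]
    rw [h₁]
    apply RingHom.isIntegral_respectsIso.2
      (e := (Scheme.ΓSpecIso (CommRingCat.of ℂ)).symm.commRingCatIsoToRingEquiv)
    exact isIntegral_appTop_of_universallyClosed _
  have : Algebra.IsIntegral ℂ Γ(X, ⊤) := ⟨hint⟩
  exact (IsAlgClosed.algebraMap_bijective_of_isIntegral (k := ℂ) (K := Γ(X, ⊤))).2

end GlobalFunctions

/-! ### Rank and degree -/

section RankDegree

variable {X : Scheme.{0}}

lemma rank_unique_of_isFreeOn [IsIntegral X] {M : X.Modules} {U U' : X.Opens} {r r' : ℕ}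
    (hU : (U : Set X).Nonempty) (hU' : (U' : Set X).Nonempty) (h : IsFreeOn M U r)
    (h' : IsFreeOn M U' r') : r = r' := by
  obtain ⟨e, he : IsBasisOn M U e⟩ := h
  obtain ⟨e', he' : IsBasisOn M U' e'⟩ := h'
  have hne := nonempty_preirreducible_inter U.2 U'.2 hU hU'
  have : Nonempty (U ⊓ U' : X.Opens) := hne.to_subtype
  have h₁ := Module.finrank_eq_card_basis (he.basis (inf_le_left : U ⊓ U' ≤ U))
  have h₂ := Module.finrank_eq_card_basis (he'.basis (inf_le_right : U ⊓ U' ≤ U'))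
  rw [h₁] at h₂
  simpa using h₂

lemma IsVectorBundle.rank_eq [IsIntegral X] {M : X.Modules} {r : ℕ} (hM : IsVectorBundle r M) :
    rank M = r := by
  obtain ⟨x⟩ := (inferInstance : Nonempty X)
  obtain ⟨U, hx, hU⟩ := hM x
  have hset : {r | ∃ U : X.Opens, (U : Set X).Nonempty ∧ IsFreeOn M U r} = {r} := by
    ext r'
    refine ⟨fun ⟨U', hU', h'⟩ => rank_unique_of_isFreeOn hU' ⟨x, hx⟩ h' hU, ?_⟩
    rintro rfl
    exact ⟨U, ⟨x, hx⟩, hU⟩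
  rw [rank, hset, csInf_singleton]

lemma not_isZero_of_isVectorBundle [IsIntegral X] {M : X.Modules} {r : ℕ} (hr : r ≠ 0)
    (hM : IsVectorBundle r M) : ¬ Limits.IsZero M := by
  intro hz
  obtain ⟨x⟩ := (inferInstance : Nonempty X)
  obtain ⟨U, hx, e, he : IsBasisOn M U e⟩ := hM x
  have : Nonempty U := ⟨⟨x, hx⟩⟩
  have hzero (m : Γ(M, U)) : m = 0 := by
    have h : 𝟙 M = 0 := hz.eq_of_src _ _
    exact congrArg (fun f : M ⟶ M => f.app U m) h
  have hne := (he.basis le_rfl).ne_zero ⟨0, Nat.pos_of_ne_zero hr⟩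
  exact hne (hzero _)

lemma isVectorBundle_structureModule : IsVectorBundle 1 (structureModule X) :=
  fun _ => ⟨⊤, trivial, _, isBasisOn_structureModule⟩

lemma dualMap_id (M : X.Modules) : dualMap (𝟙 M) = 𝟙 (dual M) := rfl

lemma dualMap_comp {M N K : X.Modules} (f : M ⟶ N) (g : N ⟶ K) :
    dualMap (f ≫ g) = dualMap g ≫ dualMap f := rfl

/-- Isomorphic sheaves have isomorphic duals. -/
def dualIso {M N : X.Modules} (e : M ≅ N) : dual M ≅ dual N where
  hom := dualMap e.inv
  inv := dualMap e.hom
  hom_inv_id := by rw [← dualMap_comp, e.hom_inv_id, dualMap_id]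
  inv_hom_id := by rw [← dualMap_comp, e.inv_hom_id, dualMap_id]

/-- The tensor product respects isomorphisms. -/
def tensorIso {M M' N N' : X.Modules} (e : M ≅ M') (f : N ≅ N') : tensor M N ≅ tensor M' N' :=
  (PresheafOfModules.sheafification (𝟙 X.ringCatSheaf.obj)).mapIso
    (MonoidalCategory.tensorIso
      (C := PresheafOfModules (X.presheaf ⋙ forget₂ CommRingCat RingCat))
      ((Scheme.Modules.toPresheafOfModules X).mapIso e)
      ((Scheme.Modules.toPresheafOfModules X).mapIso f))

/-- `𝒪_X ⊗ M ≅ M`. -/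
def tensorStructureModuleIso (M : X.Modules) : tensor (structureModule X) M ≅ M :=
  (PresheafOfModules.sheafification (𝟙 X.ringCatSheaf.obj)).mapIso
    (MonoidalCategory.leftUnitor
      (C := PresheafOfModules (X.presheaf ⋙ forget₂ CommRingCat RingCat)) M.val) ≪≫
  (asIso (PresheafOfModules.sheafificationAdjunction (𝟙 X.ringCatSheaf.obj)).counit).app M

lemma cohomologyMap_id (M : X.Modules) (i : ℕ) (x : cohomology M i) :
    cohomologyMap (𝟙 M) i x = x :=
  (congrArg (fun f => Sheaf.H.map f i x)
    ((SheafOfModules.toSheaf X.ringCatSheaf).map_id M)).trans (Sheaf.H.map_id_apply x)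

lemma cohomologyMap_comp {M N K : X.Modules} (f : M ⟶ N) (g : N ⟶ K) (i : ℕ)
    (x : cohomology M i) :
    cohomologyMap (f ≫ g) i x = cohomologyMap g i (cohomologyMap f i x) :=
  (congrArg (fun f => Sheaf.H.map f i x)
    ((SheafOfModules.toSheaf X.ringCatSheaf).map_comp f g)).trans (Sheaf.H.map_comp_apply _ _ x)

variable [X.Over (Spec (CommRingCat.of ℂ))]

lemma scalarEnd_naturality {M N : X.Modules} (f : M ⟶ N) (c : ℂ) :
    scalarEnd M c ≫ f = f ≫ scalarEnd N c := by
  ext U m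
  exact Scheme.Modules.Hom.app_smul f (scalarHom X U c) m

/-- Isomorphic sheaves have isomorphic cohomology. -/
def cohomologyEquiv {M N : X.Modules} (e : M ≅ N) (i : ℕ) :
    cohomology M i ≃ₗ[ℂ] cohomology N i where
  toFun := cohomologyMap e.hom i
  invFun := cohomologyMap e.inv i
  map_add' := map_add _
  map_smul' c x := by
    change cohomologyMap e.hom i (cohomologyMap (scalarEnd M c) i x) =
      cohomologyMap (scalarEnd N c) i (cohomologyMap e.hom i x)
    rw [← cohomologyMap_comp, ← cohomologyMap_comp, scalarEnd_naturality]
  left_inv x := by rw [← cohomologyMap_comp, e.hom_inv_id, cohomologyMap_id]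
  right_inv x := by rw [← cohomologyMap_comp, e.inv_hom_id, cohomologyMap_id]

lemma eulerChar_congr {M N : X.Modules} (e : M ≅ N) : eulerChar M = eulerChar N :=
  finsum_congr fun i => by rw [(cohomologyEquiv e i).finrank_eq]

lemma eulerDifference_congr (Ls : List X.Modules) {M N : X.Modules} (e : M ≅ N) :
    eulerDifference Ls M = eulerDifference Ls N := by
  induction Ls generalizing M N with
  | nil => exact eulerChar_congr e
  | cons L Ls ih => rw [eulerDifference, eulerDifference, ih (tensorIso (Iso.refl L) e), ih e]

lemma intersectionNumber_congr (Ls : List X.Modules) {L L' : X.Modules} (e : L ≅ L') :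
    intersectionNumber (L :: Ls) = intersectionNumber (L' :: Ls) := by
  rw [intersectionNumber, intersectionNumber, eulerDifference, eulerDifference,
    eulerDifference_congr Ls (tensorIso e (Iso.refl _))]

/-- The difference of Euler characteristics in the direction of `𝒪_X` is zero. -/
lemma intersectionNumber_structureModule (Ls : List X.Modules) :
    intersectionNumber (structureModule X :: Ls) = 0 := by
  rw [intersectionNumber, eulerDifference,
    eulerDifference_congr Ls (tensorStructureModuleIso _), sub_self]

/-- The degree depends on the determinant only. -/
lemma degree_congr (n : ℕ) (H : X.Modules) {M N : X.Modules}
    (e : extPow (rank M) M ≅ extPow (rank N) N) : degree n H M = degree n H N :=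
  intersectionNumber_congr _ (dualIso (dualIso e))

lemma degree_structureModule [IsIntegral X] (n : ℕ) (H : X.Modules) :
    degree n H (structureModule X) = 0 := by
  have hb := (isBasisOn_structureModule (X := X)).extPow.dual.dual
  obtain ⟨e⟩ := hb.nonempty_iso_structureModule
  rw [← intersectionNumber_structureModule (List.replicate (n - 1) H), degree, detSheaf,
    isVectorBundle_structureModule.rank_eq]
  exact intersectionNumber_congr _ e.symm

end RankDegree

/-! ### Morphisms and short exact sequences from sections -/

section Sections

variable {X : Scheme.{0}}

lemma mono_of_app_injective {M N : X.Modules} (f : M ⟶ N)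
    (hf : ∀ U, Function.Injective (f.app U)) : Mono f :=
  ⟨fun g h hgh => by
    ext U m
    exact hf U (congrArg (fun k : _ ⟶ N => k.app U m) hgh)⟩

/-- An epimorphism and a map that is its kernel on sections over every open set form a short exact
sequence. -/
lemma shortExact_of_sections {K M N : X.Modules} (f : K ⟶ M) (g : M ⟶ N) (w : f ≫ g = 0) [Epi g]
    (hf : ∀ U, Function.Injective (f.app U))
    (hg : ∀ U (m : Γ(M, U)), g.app U m = 0 → ∃ k, f.app U k = m) :
    (ShortComplex.mk f g w).ShortExact := by
  have hmono : Mono f := mono_of_app_injective f hf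
  let lift {A : X.Modules} (a : A ⟶ M) (ha : a ≫ g = 0) : { l : A ⟶ K // l ≫ f = a } := by
    have hrange (U : X.Opens) (m : Γ(A, U)) : appLin a U m ∈ LinearMap.range (appLin f U) :=
      hg U _ (congrArg (fun k : A ⟶ N => k.app U m) ha)
    let l (U : X.Opens) : Γ(A, U) →ₗ[Γ(X, U)] Γ(K, U) :=
      (LinearEquiv.ofInjective (appLin f U) (hf U)).symm.toLinearMap.comp
        ((appLin a U).codRestrict _ (hrange U))
    have hl (U : X.Opens) (m : Γ(A, U)) : f.app U (l U m) = a.app U m :=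
      congrArg Subtype.val ((LinearEquiv.ofInjective (appLin f U) (hf U)).apply_symm_apply _)
    refine ⟨homMk l fun {U V} h m => hf V ?_, ?_⟩
    · rw [hl, ← res_app, ← res_app, hl]
    · ext U m
      exact hl U m
  have hex : (ShortComplex.mk f g w).Exact :=
    ShortComplex.exact_of_f_is_kernel _ (Limits.KernelFork.IsLimit.ofι' f w fun a ha => lift a ha)
  exact { exact := hex, mono_f := hmono, epi_g := ‹Epi g› }

end Sections

/-! ### Bases consisting of global sections -/

section GlobalBases

variable {X : Scheme.{0}}

lemma IsBasisOn.basis_repr_res {M : X.Modules} {U : X.Opens} {ι : Type} [Fintype ι]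
    {e : ι → Γ(M, U)} (he : IsBasisOn M U e) {V W : X.Opens} (hV : V ≤ U) (hW : W ≤ V)
    (m : Γ(M, V)) (i : ι) :
    (he.basis (hW.trans hV)).repr (StableBundle.res M hW m) i =
      resO X hW ((he.basis hV).repr m i) := by
  obtain ⟨a, rfl⟩ := he.exists_eq hV m
  have h₁ := (he.basis hV).repr_sum_self a
  have h₂ := (he.basis (hW.trans hV)).repr_sum_self fun i => resO X hW (a i)
  simp only [he.basis_apply] at h₁ h₂
  rw [res_sum_smul]
  simp only [res_res]
  exact (congrFun h₂ i).trans (congrArg (resO X hW) (congrFun h₁ i)).symm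

lemma IsBasisOn.det_res {M : X.Modules} {U : X.Opens} {n : ℕ}
    {e : Fin n → Γ(M, U)} (he : IsBasisOn M U e) {V W : X.Opens} (hV : V ≤ U) (hW : W ≤ V)
    (m : Fin n → Γ(M, V)) :
    (he.basis (hW.trans hV)).det (fun j => StableBundle.res M hW (m j)) =
      resO X hW ((he.basis hV).det m) := by
  rw [Module.Basis.det_apply, Module.Basis.det_apply, RingHom.map_det]
  congr 1
  ext i j
  exact he.basis_repr_res hV hW (m j) i

/-- Sections whose determinant with respect to a basis is invertible form a basis. -/
lemma IsBasisOn.of_isUnit_det {M : X.Modules} {U : X.Opens} {n : ℕ}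
    {e : Fin n → Γ(M, U)} (he : IsBasisOn M U e) {V : X.Opens} (hV : V ≤ U)
    (m : Fin n → Γ(M, V)) (hm : IsUnit ((he.basis hV).det m)) : IsBasisOn M V m := by
  refine IsBasisOn.of_basis fun W hW => ?_
  have hu : IsUnit ((he.basis (hW.trans hV)).det fun j => StableBundle.res M hW (m j)) := by
    rw [he.det_res]
    exact hm.map _
  obtain ⟨hli, hsp⟩ := ((he.basis (hW.trans hV)).is_basis_iff_det).mpr hu
  exact ⟨Module.Basis.mk hli hsp.ge, fun i => Module.Basis.mk_apply hli hsp.ge i⟩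

/-- Multiplying the members of a basis by invertible functions gives a basis. -/
lemma IsBasisOn.isUnit_smul {M : X.Modules} {U : X.Opens} {ι : Type} [Fintype ι]
    {e : ι → Γ(M, U)} (he : IsBasisOn M U e) {u : ι → Γ(X, U)} (hu : ∀ i, IsUnit (u i)) :
    IsBasisOn M U fun i => u i • e i := by
  refine IsBasisOn.of_basis fun V hV =>
    ⟨(he.basis hV).isUnitSMul fun i => (hu i).map (resO X hV), fun i => ?_⟩
  rw [Module.Basis.isUnitSMul_apply, he.basis_apply, res_smul]

variable [X.Over (Spec (CommRingCat.of ℂ))]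

/-- If a globally generated bundle of rank `r` has `r + 1` independent global sections `s i` that
span `H⁰(E)`, then near each point `r` of them form a basis of `E`. -/
lemma exists_isBasisOn_succAbove {E : X.Modules} {r : ℕ} (hE : IsVectorBundle r E)
    (hgen : IsGloballyGenerated E) (s : Module.Basis (Fin (r + 1)) ℂ Γ(E, ⊤)) (x : X) :
    ∃ (U : X.Opens) (i : Fin (r + 1)), x ∈ U ∧
      IsBasisOn E U fun j => res E le_top (s (i.succAbove j)) := by
  obtain ⟨U, hxU, e, he : IsBasisOn E U e⟩ := hE x
  have : Epi (ev E) := hgen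
  choose V hV hxV m hm using fun j => exists_app_eq_of_epi (ev E) (e j) x hxU
  let W : X.Opens := U ⊓ Finset.univ.inf V
  have hWU : W ≤ U := inf_le_left
  have hWV (j : Fin r) : W ≤ V j := inf_le_right.trans (Finset.inf_le (Finset.mem_univ j))
  have hxW : x ∈ W := by
    refine ⟨hxU, ?_⟩
    change x ∈ ((Finset.univ.inf V : X.Opens) : Set X)
    rw [Opens.coe_finset_inf, Finset.inf_eq_iInf]
    simpa using hxV
  have hspan : Submodule.span Γ(X, W) (Set.range fun i => res E (le_top : W ≤ ⊤) (s i)) = ⊤ := by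
    rw [eq_top_iff, ← (he.basis hWU).span_eq, Submodule.span_le]
    rintro _ ⟨j, rfl⟩
    obtain ⟨a, ha⟩ := (isBasisOn_triv s).exists_eq le_top (res _ (hWV j) (m j))
    have hj : he.basis hWU j = ∑ i, a i • res E le_top (s i) := by
      rw [he.basis_apply, ← res_res E (hV j) (hWV j), ← hm, res_app, ha, app_sum_smul]
      exact Finset.sum_congr rfl fun i _ => congrArg (a i • ·)
        (trivDesc_app_constVec LinearMap.id W (s i))
    rw [hj]
    exact Submodule.sum_mem _ fun i _ => Submodule.smul_mem _ _ (Submodule.subset_span ⟨i, rfl⟩)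
  obtain ⟨c, hc⟩ := exists_sum_det_succAbove_eq_one (he.basis hWU) hspan
  obtain ⟨i, T, hT, hxT, hu⟩ := exists_isUnit_res_of_sum_eq_one _ hc x hxW
  refine ⟨T, i, hxT, he.of_isUnit_det (hT.trans hWU) _ ?_⟩
  rw [map_mul] at hu
  have := isUnit_of_mul_isUnit_right hu
  rw [← he.det_res hWU hT] at this
  simpa only [res_res] using this

end GlobalBases

/-! ### The maximal minors and the dual evaluation sequence -/

section Minors

variable {X : Scheme.{0}} {E : X.Modules} {r : ℕ}

/-- A relation between sections `s i`, all but one of which form a basis, is determined by the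
coefficient of the remaining one. -/
lemma relation_unique {s : Fin (r + 1) → Γ(E, ⊤)} {U : X.Opens} {i : Fin (r + 1)}
    (h : IsBasisOn E U fun j => res E le_top (s (i.succAbove j))) {V : X.Opens} (hV : V ≤ U)
    {a b : Fin (r + 1) → Γ(X, V)} (ha : ∑ l, a l • res E (le_top : V ≤ ⊤) (s l) = 0)
    (hb : ∑ l, b l • res E (le_top : V ≤ ⊤) (s l) = 0) (hab : a i = b i) : a = b := by
  rw [Fin.sum_univ_succAbove _ i] at ha hb
  have hsum : ∑ j, (a (i.succAbove j) - b (i.succAbove j)) •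
      res E hV (res E le_top (s (i.succAbove j))) = 0 := by
    simp only [sub_smul, Finset.sum_sub_distrib, res_res]
    rw [sub_eq_zero, eq_neg_of_add_eq_zero_right ha, eq_neg_of_add_eq_zero_right hb, hab]
  have hz := h.eq_zero hV hsum
  funext l
  obtain rfl | ⟨j, rfl⟩ := Fin.eq_self_or_eq_succAbove i l
  · exact hab
  · exact sub_eq_zero.mp (congrFun hz j)

/-- The map `φ ↦ ∑ φ(σᵢ) tᵢ` on sections of `L^*` over `U`. -/
def pairingLin {L M : X.Modules} {ι : Type} [Fintype ι] (σ : ι → Γ(L, ⊤)) (t : ι → Γ(M, ⊤))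
    (U : X.Opens) : DualSection L U →ₗ[Γ(X, U)] Γ(M, U) where
  toFun φ := ∑ i, φ.toFun U le_rfl (res L le_top (σ i)) • res M (le_top : U ≤ ⊤) (t i)
  map_add' φ ψ := by
    simp only [DualSection.add_toFun, LinearMap.add_apply, add_smul, Finset.sum_add_distrib]
  map_smul' a φ := by
    simp only [DualSection.smul_toFun, resO_self, LinearMap.smul_apply, smul_assoc,
      Finset.smul_sum, RingHom.id_apply]

/-- The morphism `L^* ⟶ M`, `φ ↦ ∑ φ(σᵢ) tᵢ`, for global sections `σᵢ` of `L` and `tᵢ` of `M`. -/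
def pairing {L M : X.Modules} {ι : Type} [Fintype ι] (σ : ι → Γ(L, ⊤)) (t : ι → Γ(M, ⊤)) :
    dual L ⟶ M :=
  homMk (M := dual L) (fun U => pairingLin σ t U) (fun {U V} h (φ : DualSection L U) => by
    refine Eq.trans (Finset.sum_congr rfl fun i _ => ?_) (res_sum_smul M h _ _).symm
    refine congrArg₂ (· • ·) ?_ (res_res M le_top h (t i)).symm
    refine Eq.trans ?_ (φ.compat U V le_rfl h _).symm
    exact congrArg (φ.toFun V h) (res_res L le_top h (σ i)).symm)

lemma pairing_app {L M : X.Modules} {ι : Type} [Fintype ι] (σ : ι → Γ(L, ⊤)) (t : ι → Γ(M, ⊤))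
    (U : X.Opens) (φ : DualSection L U) :
    (pairing σ t).app U φ =
      ∑ i, φ.toFun U le_rfl (res L le_top (σ i)) • res M (le_top : U ≤ ⊤) (t i) := rfl

variable [X.Over (Spec (CommRingCat.of ℂ))]

lemma res_smulC (M : X.Modules) {U : X.Opens} (c : ℂ) (m : Γ(M, ⊤)) :
    res M (le_top : U ≤ ⊤) (c • m) = scalarHom X U c • res M le_top m :=
  (resModC M U).map_smul c m

/-- The signed product `(-1)ⁱ s₀ ∧ ⋯ ∧ ŝᵢ ∧ ⋯ ∧ s_r` in `⋀ʳ W`. -/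
def signedWedge {W : Type} [AddCommGroup W] [Module ℂ W] (s : Fin (r + 1) → W) (i : Fin (r + 1)) :
    ⋀[ℂ]^r W :=
  (-1 : ℂ) ^ (i : ℕ) • exteriorPower.ιMulti ℂ r fun j => s (i.succAbove j)

lemma span_signedWedge {W : Type} [AddCommGroup W] [Module ℂ W] {s : Fin (r + 1) → W}
    (hs : Submodule.span ℂ (Set.range s) = ⊤) :
    Submodule.span ℂ (Set.range (signedWedge s)) = ⊤ := by
  rw [eq_top_iff, ← span_ιMulti_succAbove hs, Submodule.span_le]
  rintro _ ⟨i, rfl⟩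
  have h : (exteriorPower.ιMulti ℂ r fun j => s (i.succAbove j)) =
      (-1 : ℂ) ^ (i : ℕ) • signedWedge s i := by
    rw [signedWedge, smul_smul, ← mul_pow, neg_one_mul, neg_neg, one_pow, one_smul]
  change (exteriorPower.ιMulti ℂ r fun j => s (i.succAbove j)) ∈ _
  rw [h]
  exact Submodule.smul_mem _ _ (Submodule.subset_span ⟨i, rfl⟩)

/-- The sections `(-1)ⁱ s₀ ∧ ⋯ ∧ ŝᵢ ∧ ⋯ ∧ s_r` of `⋀ʳ E`. -/
def minor (s : Fin (r + 1) → Γ(E, ⊤)) (i : Fin (r + 1)) : Γ(extPow r E, ⊤) :=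
  detMap r E (signedWedge s i)

lemma res_minor (s : Fin (r + 1) → Γ(E, ⊤)) (i : Fin (r + 1)) (U : X.Opens) :
    res (extPow r E) (le_top : U ≤ ⊤) (minor s i) =
      ((-1) ^ (i : ℕ) : Γ(X, U)) • toExtPow r E U
        (exteriorPower.ιMulti Γ(X, U) r fun j => res E le_top (s (i.succAbove j))) := by
  rw [minor, signedWedge, map_smul, res_smulC, detMap_ιMulti, toExtPow_res, map_pow, map_neg,
    map_one]

/-- Where `r` of the sections `s i` form a basis of `E`, the corresponding minor generates
`⋀ʳ E`. -/
lemma isBasisOn_minor {s : Fin (r + 1) → Γ(E, ⊤)} {U : X.Opens} {i : Fin (r + 1)}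
    (h : IsBasisOn E U fun j => res E le_top (s (i.succAbove j))) :
    IsBasisOn (extPow r E) U fun _ : Fin 1 => res (extPow r E) le_top (minor s i) := by
  simp only [res_minor]
  exact h.extPow.isUnit_smul fun _ => (isUnit_one.neg.pow _)

/-- The relation `∑ λ(σᵢ) sᵢ = 0` between the sections `sᵢ` and their minors `σᵢ`. -/
lemma sum_minor_smul (hE : IsVectorBundle r E) (s : Fin (r + 1) → Γ(E, ⊤)) {U : X.Opens}
    (φ : DualSection (extPow r E) U) :
    ∑ i, φ.toFun U le_rfl (res (extPow r E) le_top (minor s i)) •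
      res E (le_top : U ≤ ⊤) (s i) = 0 := by
  refine eq_of_locally_eq E fun x hx => ?_
  obtain ⟨V, hxV, e, he : IsBasisOn E V e⟩ := hE x
  refine ⟨U ⊓ V, inf_le_left, ⟨hx, hxV⟩, ?_⟩
  rw [res_sum_smul, map_zero]
  refine Eq.trans (Finset.sum_congr rfl fun i _ => ?_) (sum_alternatingMap_succAbove_smul
    (he.basis (inf_le_right : U ⊓ V ≤ V))
    (((φ.toFun (U ⊓ V) inf_le_left).comp (toExtPow r E (U ⊓ V))).compAlternatingMap
      (exteriorPower.ιMulti Γ(X, U ⊓ V) r)) fun i => res E le_top (s i))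
  rw [φ.compat, res_res, res_res, res_minor, map_smul]
  rfl

/-- The inclusion `L^* ⟶ H⁰(E) ⊗ 𝒪_X`, `φ ↦ ∑ φ(σᵢ) ⊗ sᵢ`, where `L = ⋀ʳ E`. -/
def minorInclusion (s : Fin (r + 1) → Γ(E, ⊤)) : dual (extPow r E) ⟶ triv X Γ(E, ⊤) :=
  pairing (minor s) fun i => constVec (s i)

lemma ev_app_sum (s : Fin (r + 1) → Γ(E, ⊤)) {U : X.Opens} (a : Fin (r + 1) → Γ(X, U)) :
    (ev E).app U (∑ i, a i • res _ le_top (constVec (s i))) = ∑ i, a i • res E le_top (s i) := by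
  rw [app_sum_smul]
  exact Finset.sum_congr rfl fun i _ => congrArg (a i • ·)
    (trivDesc_app_constVec LinearMap.id U (s i))

lemma minorInclusion_ev (hE : IsVectorBundle r E) (s : Fin (r + 1) → Γ(E, ⊤)) :
    minorInclusion s ≫ ev E = 0 := by
  ext U φ
  change (ev E).app U ((minorInclusion s).app U φ) = 0
  refine (congrArg ((ev E).app U) (pairing_app _ _ U φ)).trans ?_
  rw [ev_app_sum]
  exact sum_minor_smul hE s φ

/-- The minors identify `L^*` with the kernel of the evaluation map. -/
lemma shortExact_minorInclusion (hE : IsVectorBundle r E) (hgen : IsGloballyGenerated E)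
    (s : Module.Basis (Fin (r + 1)) ℂ Γ(E, ⊤)) :
    (ShortComplex.mk (minorInclusion s) (ev E) (minorInclusion_ev hE s)).ShortExact := by
  have : Epi (ev E) := hgen
  have inj := app_injective_of_locally (minorInclusion s) fun x => by
    obtain ⟨U, i, hxU, h⟩ := exists_isBasisOn_succAbove hE hgen s x
    refine ⟨U, hxU, fun V hV φ ψ hφψ => ?_⟩
    have hco := (isBasisOn_triv s V le_top).1 ((pairing_app _ _ V φ).symm.trans
      (hφψ.trans (pairing_app _ _ V ψ)))
    refine DualSection.ext_of_isBasisOn (isBasisOn_minor h) hV ?_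
    rw [res_res]
    exact congrFun hco i
  refine shortExact_of_sections _ _ _ inj fun U m hm => ?_
  refine exists_app_eq_of_locally _ inj m fun x hx => ?_
  obtain ⟨V, i, hxV, h⟩ := exists_isBasisOn_succAbove hE hgen s x
  refine ⟨U ⊓ V, inf_le_left, ⟨hx, hxV⟩, ?_⟩
  obtain ⟨a, ha⟩ := (isBasisOn_triv s).exists_eq le_top (res _ (inf_le_left : U ⊓ V ≤ U) m)
  -- the linear form on `⋀ʳ E` whose value at the generator `σᵢ` is the coefficient `aᵢ` of `m`
  let φ : DualSection (extPow r E) (U ⊓ V) :=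
    a i • DualSection.restrict inf_le_right (isBasisOn_minor h).coord
  have hφ : φ.toFun (U ⊓ V) le_rfl (res _ le_top (minor s i)) = a i := by
    rw [DualSection.smul_toFun, resO_self, LinearMap.smul_apply,
      ← res_res _ le_top (inf_le_right : U ⊓ V ≤ V)]
    exact (congrArg (a i • ·) ((isBasisOn_minor h).coord_apply inf_le_right)).trans (mul_one _)
  refine ⟨φ, ?_⟩
  rw [ha]
  refine (pairing_app _ _ _ φ).trans ?_
  have hrel : ∑ l, a l • res E (le_top : U ⊓ V ≤ ⊤) (s l) = 0 := by
    rw [← ev_app_sum, ← ha, ← res_app, hm, map_zero]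
  have := relation_unique h inf_le_right (sum_minor_smul hE s φ) hrel hφ
  exact Finset.sum_congr rfl fun l _ => congrArg (· • _) (congrFun this l)

/-! ### The dual of the inclusion -/

/-- The transpose of `ι` sends `ξ ∈ W^*` to the linear form `φ ↦ ξ(ι(φ))` on `L^*`. -/
lemma trivDual_dualMap_app {V : X.Opens} {L : X.Modules} {W : Type} [AddCommGroup W] [Module ℂ W]
    (ι : dual L ⟶ triv X W) (ξ : Module.Dual ℂ W) (φ : Γ(dual L, V)) :
    (show DualSection (dual L) ⊤ from
      (trivDual W ≫ dualMap ι).app ⊤ (constVec ξ)).toFun V le_top φ =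
        (show Γ(X, V) from
          (trivDesc (M := structureModule X) ((constSection X).comp ξ)).app V (ι.app V φ)) := by
  have h : (trivDual (X := X) W).app ⊤ (constVec ξ) =
      (DualSection.ofHom (trivDesc ((constSection X).comp ξ)) : DualSection (triv X W) ⊤) :=
    trivDesc_app_top_constVec (M := dual (triv X W)) _ ξ
  exact congrArg (fun ψ : DualSection (triv X W) ⊤ => ψ.toFun V le_top (ι.app V φ)) h

lemma trivDesc_constSection_app {W : Type} [AddCommGroup W] [Module ℂ W] {ι : Type} [Fintype ι]
    (w : ι → W) (ξ : Module.Dual ℂ W) {U : X.Opens} (a : ι → Γ(X, U)) :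
    (trivDesc (M := structureModule X) ((constSection X).comp ξ)).app U
      (∑ i, a i • res (triv X W) le_top (constVec (w i))) =
        (∑ i, a i * scalarHom X U (ξ (w i)) : Γ(X, U)) := by
  rw [app_sum_smul]
  refine Finset.sum_congr rfl fun i _ => ?_
  rw [trivDesc_app_constVec]
  exact congrArg (a i * ·) (map_scalarHom (homOfLE (le_top : U ≤ ⊤)) (ξ (w i)))

/-- The compatibility of `γ` with `ι`, on sections. -/
lemma comm_iff_of_basis {W : Type} [AddCommGroup W] [Module ℂ W] {ι : Type} [Fintype ι]
    (b : Module.Basis ι ℂ (Module.Dual ℂ W)) {L : X.Modules} (i : dual L ⟶ triv X W)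
    (γ : triv X (Module.Dual ℂ W) ⟶ L) :
    γ ≫ toBidual L = trivDual W ≫ dualMap i ↔ ∀ (l : ι) (V : X.Opens) (φ : DualSection L V),
      φ.toFun V le_rfl (res L le_top (γ.app ⊤ (constVec (b l)))) =
        (show Γ(X, V) from
          (trivDesc (M := structureModule X) ((constSection X).comp (b l))).app V (i.app V φ)) := by
  refine ⟨fun h l V φ => ?_, fun h => triv_hom_ext b fun l => ?_⟩
  · exact (congrArg (fun f : triv X (Module.Dual ℂ W) ⟶ dual (dual L) =>
      DualSection.toFun (M := dual L) (U := ⊤) (f.app ⊤ (constVec (b l))) V le_top φ) h).trans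
        (trivDual_dualMap_app i (b l) φ)
  · apply DualSection.ext (M := dual L)
    funext V hV
    ext φ
    exact (h l V φ).trans (trivDual_dualMap_app i (b l) φ).symm

/-- The dual evaluation sequence of a globally generated bundle of rank `r` with `r + 1` independent
sections. -/
def minorDualEvaluation (hE : IsVectorBundle r E) (hgen : IsGloballyGenerated E)
    (s : Module.Basis (Fin (r + 1)) ℂ Γ(E, ⊤)) : DualEvaluation r E where
  ι := minorInclusion s
  zero := minorInclusion_ev hE s
  exact := shortExact_minorInclusion hE hgen s
  γ := trivDesc (∑ i, (Module.Dual.eval ℂ Γ(E, ⊤) (s i)).smulRight (minor s i))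
  comm := by
    classical
    refine (comm_iff_of_basis s.dualBasis _ _).mpr fun l V φ => ?_
    have h := (congrArg ((trivDesc (M := structureModule X)
      ((constSection X).comp (s.dualBasis l))).app V)
      (pairing_app (minor s) (fun i => constVec (s i)) V φ)).trans
      (trivDesc_constSection_app s (s.dualBasis l) _)
    refine Eq.trans ?_ h.symm
    rw [trivDesc_app_top_constVec, LinearMap.sum_apply, map_sum, map_sum]
    refine Finset.sum_congr rfl fun i _ => ?_
    rw [LinearMap.smulRight_apply, res_smulC, map_smul, smul_eq_mul, mul_comm]
    rfl

/-- For any dual evaluation sequence, `ι(φ) = ∑ φ(τᵢ) ⊗ sᵢ`, where `τᵢ` is the image under `γ` of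
the linear form dual to `sᵢ`. -/
lemma DualEvaluation.ι_app (D : DualEvaluation r E) (s : Module.Basis (Fin (r + 1)) ℂ Γ(E, ⊤))
    {V : X.Opens} (φ : DualSection (extPow r E) V) :
    D.ι.app V φ = ∑ i, φ.toFun V le_rfl (res (extPow r E) le_top
      (D.γ.app ⊤ (constVec (s.dualBasis i)))) • res (triv X Γ(E, ⊤)) le_top (constVec (s i)) := by
  classical
  obtain ⟨a, ha⟩ := (isBasisOn_triv s).exists_eq le_top (D.ι.app V φ)
  rw [ha]
  refine Finset.sum_congr rfl fun l _ => congrArg (· • _) ?_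
  have h := ((comm_iff_of_basis s.dualBasis D.ι D.γ).mp D.comm l V φ)
  rw [h]
  refine Eq.trans ?_ (congrArg ((trivDesc (M := structureModule X)
      ((constSection X).comp (s.dualBasis l))).app V) ha).symm
  refine Eq.trans ?_ (trivDesc_constSection_app s (s.dualBasis l) a).symm
  rw [Finset.sum_eq_single l]
  · rw [Module.Basis.dualBasis_apply_self, if_pos rfl, map_one, mul_one]
  · intro j _ hj
    rw [Module.Basis.dualBasis_apply_self, if_neg hj, map_zero, mul_zero]
  · intro h; exact absurd (Finset.mem_univ l) h

end Minors

/-! ### The image of the determinant map -/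

section Images

variable {X : Scheme.{0}} [X.Over (Spec (CommRingCat.of ℂ))] {E : X.Modules} {r : ℕ}

lemma range_detMap {s : Fin (r + 1) → Γ(E, ⊤)} (hs : Submodule.span ℂ (Set.range s) = ⊤) :
    LinearMap.range (detMap r E) = Submodule.span ℂ (Set.range (minor s)) := by
  rw [LinearMap.range_eq_map, ← span_signedWedge hs, Submodule.map_span, ← Set.range_comp]
  rfl

/-- As global functions are constant, `H⁰(W ⊗ 𝒪_X) = W`. -/
lemma range_H0map_triv [IsIntegral X] (hproj : IsProjective X) {W : Type} [AddCommGroup W]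
    [Module ℂ W] {ι : Type} [Fintype ι] (b : Module.Basis ι ℂ W) {M : X.Modules}
    (f : triv X W ⟶ M) :
    LinearMap.range (H0map f) =
      Submodule.span ℂ (Set.range fun i => f.app ⊤ (constVec (b i))) := by
  have hspan : Submodule.span ℂ (Set.range fun i => (constVec (b i) : Γ(triv X W, ⊤))) = ⊤ := by
    refine eq_top_iff.mpr fun m _ => ?_
    obtain ⟨a, rfl⟩ := (isBasisOn_triv b).exists_eq le_rfl m
    refine Submodule.sum_mem _ fun i _ => ?_
    obtain ⟨c, hc⟩ := scalarHom_top_surjective hproj (a i)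
    rw [res_self, ← hc]
    exact Submodule.smul_mem _ c (Submodule.subset_span ⟨i, rfl⟩)
  rw [LinearMap.range_eq_map, ← hspan, Submodule.map_span, ← Set.range_comp]
  rfl

/-- Sections `τᵢ` of `⋀ʳ E` satisfying the same relation `∑ λ(τᵢ) sᵢ = 0` as the minors of the
`sᵢ` are a common multiple of them. -/
lemma exists_smul_minor (hE : IsVectorBundle r E) (hgen : IsGloballyGenerated E)
    (s : Module.Basis (Fin (r + 1)) ℂ Γ(E, ⊤)) (τ : Fin (r + 1) → Γ(extPow r E, ⊤))
    (hτ : ∀ (U : X.Opens) (φ : DualSection (extPow r E) U),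
      ∑ i, φ.toFun U le_rfl (res (extPow r E) le_top (τ i)) • res E (le_top : U ≤ ⊤) (s i) = 0) :
    ∃ a : Γ(X, ⊤), ∀ i, τ i = a • minor s i := by
  have loc (x : X) : ∃ (U : X.Opens) (u : Γ(X, U)) (j : Fin (r + 1)), x ∈ U ∧
      IsBasisOn (extPow r E) U (fun _ : Fin 1 => res (extPow r E) le_top (minor s j)) ∧
      ∀ i, res (extPow r E) (le_top : U ≤ ⊤) (τ i) = u • res _ le_top (minor s i) := by
    obtain ⟨U, j, hxU, h⟩ := exists_isBasisOn_succAbove hE hgen s x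
    have hm := isBasisOn_minor h
    let u : Γ(X, U) := hm.coord.toFun U le_rfl (res _ le_top (τ j))
    have hone : hm.coord.toFun U le_rfl (res _ le_top (minor s j)) = 1 := by
      have := hm.coord_apply le_rfl
      rwa [res_self] at this
    have hrel : ∑ i, (u * hm.coord.toFun U le_rfl (res (extPow r E) le_top (minor s i))) •
        res E (le_top : U ≤ ⊤) (s i) = 0 := by
      simp only [mul_smul, ← Finset.smul_sum]
      rw [sum_minor_smul hE s hm.coord, smul_zero]
    have key := relation_unique h le_rfl (hτ U hm.coord) hrel (by rw [hone, mul_one])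
    refine ⟨U, u, j, hxU, hm, fun i => ?_⟩
    -- a section of the line bundle is determined by its coordinate
    refine ((hm.basis le_rfl).ext_elem fun k => ?_)
    obtain rfl : k = 0 := Subsingleton.elim _ _
    rw [map_smul]
    exact congrFun key i
  choose U u j hxU hm hu using loc
  have uniq (x y : X) (T : X.Opens) (h₁ : T ≤ U x) (h₂ : T ≤ U y) :
      resO X h₁ (u x) = resO X h₂ (u y) := by
    have e := (congrArg (res _ h₁) (hu x (j x))).symm.trans
      ((res_res _ _ h₁ _).trans ((res_res _ _ h₂ _).symm.trans (congrArg (res _ h₂) (hu y (j x)))))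
    rw [res_smul, res_smul, res_res, res_res] at e
    have := ((hm x) T h₁).1 (a₁ := fun _ => resO X h₁ (u x)) (a₂ := fun _ => resO X h₂ (u y)) (by
      simpa only [res_res, Fintype.sum_unique] using e)
    exact congrFun this 0
  obtain ⟨a, ha⟩ := exists_glueO (V := ⊤) (fun x _ => U x) (fun _ _ => le_top) (fun x _ => hxU x)
    (fun x _ => u x) (fun x _ y _ T h₁ h₂ => uniq x y T h₁ h₂)
  refine ⟨a, fun i => eq_of_locally_eq _ fun x _ => ⟨U x, le_top, hxU x, ?_⟩⟩
  rw [hu x i, res_smul, ha x trivial]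

/-- `γ` maps the linear form dual to `sᵢ` to a common nonzero multiple of the `i`-th minor. -/
lemma DualEvaluation.exists_smul_minor [IsIntegral X] (hproj : IsProjective X)
    (hE : IsVectorBundle r E) (hgen : IsGloballyGenerated E)
    (s : Module.Basis (Fin (r + 1)) ℂ Γ(E, ⊤)) (D : DualEvaluation r E) :
    ∃ c : ℂ, c ≠ 0 ∧ ∀ i, D.γ.app ⊤ (constVec (s.dualBasis i)) = c • minor s i := by
  obtain ⟨a, ha⟩ := StableBundle.exists_smul_minor hE hgen s
    (fun i => D.γ.app ⊤ (constVec (s.dualBasis i))) fun U φ => by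
      rw [← ev_app_sum, ← D.ι_app s φ]
      exact congrArg (fun f : dual (extPow r E) ⟶ E => f.app U φ) D.zero
  obtain ⟨c, rfl⟩ := scalarHom_top_surjective hproj a
  refine ⟨c, ?_, ha⟩
  rintro rfl
  have hι : D.ι = 0 := by
    ext U φ
    refine (D.ι_app s φ).trans (Finset.sum_eq_zero fun i _ => ?_)
    rw [ha i, map_zero, zero_smul, map_zero, map_zero, zero_smul]
  have : Mono D.ι := D.exact.mono_f
  refine not_isZero_of_isVectorBundle (r := 1) one_ne_zero (fun x => ?_)
    (Limits.IsZero.of_mono_eq_zero D.ι hι)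
  obtain ⟨U, hxU, e, he : IsBasisOn E U e⟩ := hE x
  exact ⟨U, hxU, _, he.extPow.dual⟩

theorem DualEvaluation.range_detMap_eq [IsIntegral X] (hproj : IsProjective X)
    (hE : IsVectorBundle r E) (hgen : IsGloballyGenerated E)
    (s : Module.Basis (Fin (r + 1)) ℂ Γ(E, ⊤)) (D : DualEvaluation r E) :
    LinearMap.range (detMap r E) = LinearMap.range (H0map D.γ) := by
  classical
  obtain ⟨c, hc, h⟩ := D.exists_smul_minor hproj hE hgen s
  rw [range_detMap s.span_eq, range_H0map_triv hproj s.dualBasis]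
  simp only [h]
  refine le_antisymm (Submodule.span_le.mpr ?_) (Submodule.span_le.mpr ?_)
  · rintro _ ⟨i, rfl⟩
    have := Submodule.smul_mem _ c⁻¹ (Submodule.subset_span (R := ℂ) ⟨i, rfl⟩ :
      c • minor s i ∈ Submodule.span ℂ (Set.range fun i => c • minor s i))
    rwa [inv_smul_smul₀ hc] at this
  · rintro _ ⟨i, rfl⟩
    exact Submodule.smul_mem _ c (Submodule.subset_span ⟨i, rfl⟩)

end Images

/-! ### Bundles with a trivial direct summand -/

section Splitting

variable {X : Scheme.{0}} {E F : X.Modules} {k : ℕ}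

/-- The exchange lemma: a section whose `i`-th coordinate is invertible may replace the `i`-th
member of a basis. -/
lemma IsBasisOn.cons_succAbove {U : X.Opens} {e : Fin (k + 1) → Γ(E, U)} (he : IsBasisOn E U e)
    {a : Fin (k + 1) → Γ(X, U)} {i : Fin (k + 1)} (ha : IsUnit (a i)) :
    IsBasisOn E U (Fin.cons (∑ l, a l • e l) fun l => e (i.succAbove l) :
      Fin (k + 1) → Γ(E, U)) := by
  intro V hV
  have hsum (b : Fin (k + 1) → Γ(X, V)) :
      ∑ l, b l • StableBundle.res E hV ((Fin.cons (∑ l, a l • e l) fun l => e (i.succAbove l) :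
        Fin (k + 1) → Γ(E, U)) l) =
      (b 0 * resO X hV (a i)) • StableBundle.res E hV (e i) +
        ∑ l : Fin k, (b 0 * resO X hV (a (i.succAbove l)) + b l.succ) •
          StableBundle.res E hV (e (i.succAbove l)) := by
    rw [Fin.sum_univ_succ, Fin.cons_zero, res_sum_smul, Fin.sum_univ_succAbove _ i, smul_add,
      smul_smul, Finset.smul_sum, add_assoc, ← Finset.sum_add_distrib]
    simp only [Fin.cons_succ, add_smul, mul_smul]
  have hu := ha.map (resO X hV)
  refine ⟨fun b b' hbb => ?_, fun m => ?_⟩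
  · simp only [hsum] at hbb
    have := (he V hV).1 (a₁ := i.insertNth (b 0 * resO X hV (a i)) fun l =>
      b 0 * resO X hV (a (i.succAbove l)) + b l.succ) (a₂ := i.insertNth (b' 0 * resO X hV (a i))
      fun l => b' 0 * resO X hV (a (i.succAbove l)) + b' l.succ) (by
        simpa only [Fin.sum_univ_succAbove _ i, Fin.insertNth_apply_same,
          Fin.insertNth_apply_succAbove] using hbb)
    have h0 : b 0 = b' 0 := hu.mul_right_cancel (by simpa using congrFun this i)
    funext l
    refine Fin.cases h0 (fun l => ?_) l
    have := congrFun this (i.succAbove l)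
    simpa only [Fin.insertNth_apply_succAbove, h0, add_right_inj] using this
  · obtain ⟨b, rfl⟩ := he.exists_eq hV m
    obtain ⟨u, hu⟩ := hu
    refine ⟨Fin.cons (b i * ↑u⁻¹) fun l =>
      b (i.succAbove l) - b i * ↑u⁻¹ * resO X hV (a (i.succAbove l)), ?_⟩
    beta_reduce
    rw [hsum, Fin.sum_univ_succAbove _ i]
    simp only [Fin.cons_zero, Fin.cons_succ, add_sub_cancel, ← hu, Units.inv_mul_cancel_right]

/-- A decomposition `E ≅ F ⊕ 𝒪_X`, given by `j : F ⟶ E` and a section `v` of `E` and by the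
projections `p` and `φ`, on the level of sections. -/
structure TrivialSummand (E F : X.Modules) where
  j : F ⟶ E
  p : E ⟶ F
  φ : E ⟶ structureModule X
  v : Γ(E, ⊤)
  p_j : ∀ (U : X.Opens) (f : Γ(F, U)), p.app U (j.app U f) = f
  j_p : ∀ (U : X.Opens) (m : Γ(E, U)),
    j.app U (p.app U m) + (show Γ(X, U) from φ.app U m) • res E le_top v = m
  φ_j : ∀ (U : X.Opens) (f : Γ(F, U)), φ.app U (j.app U f) = 0
  φ_v : ∀ U : X.Opens, φ.app U (res E le_top v) = (1 : Γ(X, U))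
  p_v : ∀ U : X.Opens, p.app U (res E le_top v) = 0

/-- A linear form on `E` which takes the value `1` at a global section splits off `𝒪_X`. -/
def TrivialSummand.ofHom (φ : E ⟶ structureModule X) (v : Γ(E, ⊤))
    (h : φ.app ⊤ v = (1 : Γ(X, ⊤))) : TrivialSummand E (Limits.kernel φ) := by
  have hv (U : X.Opens) : φ.app U (res E le_top v) = (1 : Γ(X, U)) := by
    rw [← res_app, h]
    exact map_one (resO X (le_top : U ≤ ⊤))
  have hφ : (𝟙 E - φ ≫ sectionHom v) ≫ φ = 0 := by
    have : sectionHom v ≫ φ = 𝟙 _ := by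
      ext U a
      refine (Scheme.Modules.Hom.app_smul φ (U := U) a (res E le_top v)).trans ?_
      rw [hv]
      exact mul_one (M := Γ(X, U)) a
    rw [Preadditive.sub_comp, Category.assoc, this, Category.comp_id, Category.id_comp, sub_self]
  have hjp : Limits.kernel.ι φ ≫ Limits.kernel.lift φ _ hφ = 𝟙 _ := by
    rw [← cancel_mono (Limits.kernel.ι φ), Category.assoc, Limits.kernel.lift_ι,
      Preadditive.comp_sub, Category.comp_id, Limits.kernel.condition_assoc, Limits.zero_comp,
      sub_zero, Category.id_comp]
  have hpj : Limits.kernel.lift φ _ hφ ≫ Limits.kernel.ι φ + φ ≫ sectionHom v = 𝟙 E := by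
    rw [Limits.kernel.lift_ι, sub_add_cancel]
  have p_j (U : X.Opens) (f : Γ(Limits.kernel φ, U)) :
      (Limits.kernel.lift φ _ hφ).app U ((Limits.kernel.ι φ).app U f) = f :=
    congrArg (fun g : Limits.kernel φ ⟶ Limits.kernel φ => g.app U f) hjp
  have j_p (U : X.Opens) (m : Γ(E, U)) :
      (Limits.kernel.ι φ).app U ((Limits.kernel.lift φ _ hφ).app U m) +
        (show Γ(X, U) from φ.app U m) • res E le_top v = m :=
    congrArg (fun g : E ⟶ E => g.app U m) hpj
  exact
    { j := Limits.kernel.ι φ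
      p := Limits.kernel.lift φ _ hφ
      φ := φ
      v := v
      p_j := p_j
      j_p := j_p
      φ_j := fun U f => congrArg (fun g : Limits.kernel φ ⟶ structureModule X => g.app U f)
        (Limits.kernel.condition φ)
      φ_v := hv
      p_v := fun U => by
        have h₁ := j_p U (res E le_top v)
        rw [hv] at h₁
        change _ + (1 : Γ(X, U)) • _ = _ at h₁
        rw [one_smul, add_eq_right] at h₁
        have h₂ := congrArg ((Limits.kernel.lift φ _ hφ).app U) h₁
        rwa [p_j, map_zero] at h₂ }

namespace TrivialSummand

variable (T : TrivialSummand E F)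

lemma exists_eq_add_smul {U : X.Opens} (m : Γ(E, U)) :
    ∃ a : Γ(X, U), T.j.app U (T.p.app U m) + a • res E le_top T.v = m :=
  ⟨_, T.j_p U m⟩

lemma mono_j : Mono T.j :=
  mono_of_app_injective T.j fun U => Function.LeftInverse.injective (T.p_j U)

lemma mono_sectionHom : Mono (sectionHom T.v) :=
  mono_of_app_injective _ fun U => Function.LeftInverse.injective (g := T.φ.app U) fun a => by
    refine (Scheme.Modules.Hom.app_smul T.φ (U := U) a (res E le_top T.v)).trans ?_
    rw [T.φ_v]
    exact mul_one (M := Γ(X, U)) a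

/-- If `v` and the `g l` form a basis of `E`, the projections of the `g l` form a basis of `F`. -/
lemma isBasisOn_of_cons {U : X.Opens} {g : Fin k → Γ(E, U)}
    (hg : IsBasisOn E U (Fin.cons (res E le_top T.v) g : Fin (k + 1) → Γ(E, U))) :
    IsBasisOn F U fun l => T.p.app U (g l) := by
  intro V hV
  have hsum (c : Fin k → Γ(X, V)) : ∑ l, c l • res F hV (T.p.app U (g l)) =
      T.p.app V (∑ l, c l • res E hV (g l)) := by
    rw [app_sum_smul]
    simp only [res_app]
  refine ⟨(injective_iff_map_eq_zero' (Fintype.linearCombination Γ(X, V) fun l =>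
    res F hV (T.p.app U (g l)))).mpr fun c => ⟨fun hc => ?_, fun hc => ?_⟩, fun f => ?_⟩
  · have hc' : T.p.app V (∑ l, c l • res E hV (g l)) = 0 := (hsum c).symm.trans hc
    obtain ⟨a, h₁⟩ := T.exists_eq_add_smul (∑ l, c l • res E hV (g l))
    rw [hc', map_zero, zero_add] at h₁
    have h₂ := hg.eq_zero hV (a := Fin.cons (-a) c) (by
        rw [Fin.sum_univ_succ]
        simp only [Fin.cons_zero, Fin.cons_succ, res_res, neg_smul]
        rw [h₁, neg_add_cancel])
    funext l
    exact congrFun h₂ l.succ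
  · rw [hc, map_zero]
  · obtain ⟨c, hc⟩ := hg.exists_eq hV (T.j.app V f)
    refine ⟨fun l => c l.succ, (hsum _).trans ?_⟩
    rw [Fin.sum_univ_succ] at hc
    simp only [Fin.cons_zero, Fin.cons_succ, res_res] at hc
    have := congrArg (T.p.app V) hc
    rw [T.p_j, map_add, Scheme.Modules.Hom.app_smul, T.p_v, smul_zero, zero_add] at this
    exact this.symm

/-- A basis of `F` together with `v` is a basis of `E`. -/
lemma isBasisOn_cons {U : X.Opens} {f : Fin k → Γ(F, U)} (hf : IsBasisOn F U f) :
    IsBasisOn E U (Fin.cons (res E le_top T.v) fun l => T.j.app U (f l) :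
      Fin (k + 1) → Γ(E, U)) := by
  intro V hV
  have hsum (c : Fin (k + 1) → Γ(X, V)) :
      ∑ l, c l • res E hV ((Fin.cons (res E le_top T.v) fun l => T.j.app U (f l) :
        Fin (k + 1) → Γ(E, U)) l) =
      c 0 • res E le_top T.v + T.j.app V (∑ l, c l.succ • res F hV (f l)) := by
    rw [app_sum_smul, Fin.sum_univ_succ]
    simp only [Fin.cons_zero, Fin.cons_succ, res_res, res_app]
  refine ⟨(injective_iff_map_eq_zero (Fintype.linearCombination Γ(X, V) fun l =>
    res E hV ((Fin.cons (res E le_top T.v) fun l => T.j.app U (f l) :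
        Fin (k + 1) → Γ(E, U)) l))).mpr fun c hc => ?_, fun m => ?_⟩
  · have hc' := (hsum c).symm.trans hc
    have h₁ := congrArg (T.p.app V) hc'
    rw [map_add, Scheme.Modules.Hom.app_smul, T.p_v, smul_zero, zero_add, T.p_j, map_zero] at h₁
    have h₂ := congrArg (T.φ.app V) hc'
    rw [map_add, Scheme.Modules.Hom.app_smul, T.φ_v, T.φ_j, add_zero, map_zero] at h₂
    have h₃ := hf.eq_zero hV h₁
    funext l
    refine Fin.cases ?_ (fun l => congrFun h₃ l) l
    exact (mul_one (M := Γ(X, V)) (c 0)).symm.trans h₂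
  · obtain ⟨c, hc⟩ := hf.exists_eq hV (T.p.app V m)
    obtain ⟨a, ha⟩ := T.exists_eq_add_smul m
    refine ⟨Fin.cons a c, (hsum _).trans ?_⟩
    simp only [Fin.cons_zero, Fin.cons_succ]
    rw [← hc, add_comm, ha]

lemma isVectorBundle (T : TrivialSummand E F) (hE : IsVectorBundle (k + 1) E) : IsVectorBundle k F := by
  intro x
  obtain ⟨U, hxU, e, he : IsBasisOn E U e⟩ := hE x
  obtain ⟨a, ha⟩ := he.exists_eq le_rfl (res E le_top T.v)
  have hone : ∑ l, a l * (show Γ(X, U) from T.φ.app U (e l)) = 1 := by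
    rw [← T.φ_v U, ha, app_sum_smul]
    simp only [res_self]
    rfl
  -- near `x`, some coordinate of `v` is invertible, so `v` can replace a member of the basis `e`
  obtain ⟨i, V, hV, hxV, hu⟩ := exists_isUnit_res_of_sum_eq_one _ hone x hxU
  rw [map_mul] at hu
  have hb := (he.res hV).cons_succAbove (a := fun l => resO X hV (a l))
    (isUnit_of_mul_isUnit_left hu)
  have hv : ∑ l, resO X hV (a l) • res E hV (e l) = res E le_top T.v := by
    rw [← res_sum_smul, ← res_res E le_top hV, ha]
    simp only [res_self]
  rw [hv] at hb
  exact ⟨V, hxV, _, T.isBasisOn_of_cons hb⟩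

end TrivialSummand

/-- The map `f₁ ∧ ⋯ ∧ f_k ↦ v ∧ j f₁ ∧ ⋯ ∧ j f_k` on sections over `U`. -/
def wedgeLeftLin (k : ℕ) (v : Γ(E, ⊤)) (j : F ⟶ E) (U : X.Opens) :
    (⋀[Γ(X, U)]^k Γ(F, U)) →ₗ[Γ(X, U)] Γ(extPow (k + 1) E, U) :=
  exteriorPower.alternatingMapLinearEquiv
    ((((toExtPow (k + 1) E U).compAlternatingMap
      (exteriorPower.ιMulti Γ(X, U) (k + 1))).curryLeft (res E le_top v)).compLinearMap
        (appLin j U))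

lemma wedgeLeftLin_ιMulti (v : Γ(E, ⊤)) (j : F ⟶ E) (U : X.Opens) (f : Fin k → Γ(F, U)) :
    wedgeLeftLin k v j U (exteriorPower.ιMulti Γ(X, U) k f) =
      toExtPow (k + 1) E U (exteriorPower.ιMulti Γ(X, U) (k + 1)
        (Fin.cons (res E le_top v) fun l => j.app U (f l))) :=
  exteriorPower.alternatingMapLinearEquiv_apply_ιMulti _ _

lemma wedgeLeftLin_res (v : Γ(E, ⊤)) (j : F ⟶ E) {U V : X.Opens} (i : V ⟶ U)
    (x : ⋀[Γ(X, U)]^k Γ(F, U)) :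
    wedgeLeftLin k v j V (exteriorRes F k i x) =
      res (extPow (k + 1) E) (leOfHom i) (wedgeLeftLin k v j U x) := by
  have hx : x ∈ Submodule.span Γ(X, U) (Set.range (exteriorPower.ιMulti Γ(X, U) k
      (M := Γ(F, U)))) := by
    rw [exteriorPower.ιMulti_span]; trivial
  induction hx using Submodule.span_induction with
  | mem x h =>
    obtain ⟨f, rfl⟩ := h
    rw [exteriorRes, exteriorMapSL_ιMulti, wedgeLeftLin_ιMulti, wedgeLeftLin_ιMulti, toExtPow_res]
    congr 2
    funext l
    refine Fin.cases ?_ (fun l => ?_) l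
    · exact (res_res E le_top (leOfHom i) v).symm
    · exact (res_app j (leOfHom i) (f l)).symm
  | zero => simp only [map_zero]
  | add x y _ _ hx hy => rw [map_add, map_add, hx, hy, map_add, map_add]
  | smul a x _ hx =>
    rw [map_smulₛₗ, map_smul, hx, map_smul, res_smul]
    rfl

/-- The morphism `⋀ᵏ F ⟶ ⋀ᵏ⁺¹ E`, `f₁ ∧ ⋯ ∧ f_k ↦ v ∧ j f₁ ∧ ⋯ ∧ j f_k`. -/
def wedgeLeft (k : ℕ) (v : Γ(E, ⊤)) (j : F ⟶ E) : extPow k F ⟶ extPow (k + 1) E :=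
  sheafifyDesc (P := exteriorPresheaf F k) (PresheafOfModules.homMk
    (M₁ := exteriorPresheaf F k) (M₂ := (extPow (k + 1) E).val)
    { app := fun U => AddCommGrpCat.ofHom (wedgeLeftLin k v j U.unop).toAddMonoidHom
      naturality := fun _ _ i => AddCommGrpCat.hom_ext (AddMonoidHom.ext fun x =>
        wedgeLeftLin_res v j i.unop x) }
    (fun U a x => (wedgeLeftLin k v j U.unop).map_smul a x))

lemma wedgeLeft_app_toExtPow (v : Γ(E, ⊤)) (j : F ⟶ E) (U : X.Opens) (f : Fin k → Γ(F, U)) :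
    (wedgeLeft k v j).app U (toExtPow k F U (exteriorPower.ιMulti Γ(X, U) k f)) =
      toExtPow (k + 1) E U (exteriorPower.ιMulti Γ(X, U) (k + 1)
        (Fin.cons (res E le_top v) fun l => j.app U (f l))) :=
  (sheafifyDesc_unit (P := exteriorPresheaf F k) _ U _).trans (wedgeLeftLin_ιMulti v j U f)

/-- Splitting off a trivial summand does not change the determinant. -/
lemma TrivialSummand.isIso_wedgeLeft (T : TrivialSummand E F) (hF : IsVectorBundle k F) :
    IsIso (wedgeLeft k T.v T.j) := by
  refine isIso_of_locally_isBasisOn _ fun x => ?_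
  obtain ⟨U, hxU, f, hf : IsBasisOn F U f⟩ := hF x
  refine ⟨U, 1, _, hxU, hf.extPow, ?_⟩
  simp only [wedgeLeft_app_toExtPow]
  exact (T.isBasisOn_cons hf).extPow

end Splitting

/-! ### Stability and injectivity of the determinant map -/

section Stable

variable {X : Scheme.{0}} [X.Over (Spec (CommRingCat.of ℂ))] [IsIntegral X] {E : X.Modules}

lemma TrivialSummand.degree_eq {F : X.Modules} {k : ℕ} (T : TrivialSummand E F)
    (hE : IsVectorBundle (k + 1) E) (n : ℕ) (H : X.Modules) : degree n H F = degree n H E := by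
  have hF := T.isVectorBundle hE
  have := T.isIso_wedgeLeft hF
  refine degree_congr n H ?_
  rw [hF.rank_eq, hE.rank_eq]
  exact asIso (wedgeLeft k T.v T.j)

/-- A stable bundle of rank at least `2` has no trivial direct summand: otherwise `𝒪_X` would force
its degree to be positive, and the complement to be nonpositive. -/
theorem TrivialSummand.not_isMuStable {F : X.Modules} {r : ℕ} (T : TrivialSummand E F)
    (hr : 2 ≤ r) (hE : IsVectorBundle r E) (n : ℕ) (H : X.Modules) : ¬ IsMuStable n H E := by
  obtain ⟨k, rfl⟩ : ∃ k, r = k + 1 := ⟨r - 1, by omega⟩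
  have hk : 1 ≤ k := by omega
  have hF := T.isVectorBundle hE
  have hO := isVectorBundle_structureModule (X := X)
  intro hstable
  have h₁ := hstable _ (sectionHom T.v) hO.isCoherent T.mono_sectionHom
    (not_isZero_of_isVectorBundle one_ne_zero hO) (by rw [hO.rank_eq, hE.rank_eq]; omega)
  have h₂ := hstable _ T.j hF.isCoherent T.mono_j
    (not_isZero_of_isVectorBundle (by omega) hF) (by rw [hF.rank_eq, hE.rank_eq]; omega)
  rw [slope, slope, degree_structureModule, hE.rank_eq, Int.cast_zero, zero_div] at h₁
  rw [slope, slope, T.degree_eq hE, hE.rank_eq, hF.rank_eq] at h₂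
  have hk' : (0 : ℚ) < k := by exact_mod_cast hk
  have hk₁ : (0 : ℚ) < ((k + 1 : ℕ) : ℚ) := by positivity
  have hd : (0 : ℚ) < degree n H E := (div_pos_iff_of_pos_right hk₁).mp h₁
  refine absurd h₂ (not_lt.mpr ?_)
  exact div_le_div_of_nonneg_left hd.le hk' (by push_cast; linarith)

/-- A kernel element of the determinant map gives a linear form on `E` which does not vanish on
global sections, so it splits off a trivial summand. -/
theorem injective_detMap {r : ℕ} (hr : 2 ≤ r) (hE : IsVectorBundle r E)
    (hgen : IsGloballyGenerated E) (s : Module.Basis (Fin (r + 1)) ℂ Γ(E, ⊤)) {n : ℕ}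
    {H : X.Modules} (hstable : IsMuStable n H E) : Function.Injective (detMap r E) := by
  refine (injective_iff_map_eq_zero (detMap r E)).mpr fun ω hω => ?_
  obtain ⟨c, rfl⟩ : ∃ c : Fin (r + 1) → ℂ, ∑ i, c i • signedWedge s i = ω :=
    (Submodule.mem_span_range_iff_exists_fun ℂ).mp (by rw [span_signedWedge s.span_eq]; trivial)
  by_contra hne
  obtain ⟨i, hi⟩ : ∃ i, c i ≠ 0 := by
    by_contra! h
    exact hne (Finset.sum_eq_zero fun i _ => by rw [h i, zero_smul])
  have hσ : ∑ i, c i • minor s i = 0 := by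
    rw [map_sum] at hω
    exact Eq.trans (Finset.sum_congr rfl fun l _ => ((detMap r E).map_smul _ _).symm) hω
  let ξ : Module.Dual ℂ Γ(E, ⊤) := s.constr ℂ c
  have hξ (l : Fin (r + 1)) : ξ (s l) = c l := s.constr_basis ℂ c l
  have : Epi (ev E) := hgen
  have hzero : minorInclusion s ≫ trivDesc (M := structureModule X) ((constSection X).comp ξ) =
      0 := by
    ext U φ
    have h₁ := (congrArg ((trivDesc (M := structureModule X)
      ((constSection X).comp ξ)).app U)
      (pairing_app (minor s) (fun i => constVec (s i)) U φ)).trans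
      (trivDesc_constSection_app s ξ _)
    refine h₁.trans ?_
    have h₂ := congrArg (DualSection.toFun (M := extPow r E) φ U le_rfl)
      (congrArg (res (extPow r E) (le_top : U ≤ ⊤)) hσ)
    rw [map_sum, map_sum, map_zero, map_zero] at h₂
    refine Eq.trans (Finset.sum_congr rfl fun l _ => ?_) h₂
    rw [hξ, res_smulC, map_smul, smul_eq_mul, mul_comm]
  let φ := (shortExact_minorInclusion hE hgen s).exact.desc _ hzero
  have hφ : ev E ≫ φ = trivDesc ((constSection X).comp ξ) :=
    (shortExact_minorInclusion hE hgen s).exact.g_desc _ hzero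
  have hv : φ.app ⊤ ((c i)⁻¹ • s i) = (1 : Γ(X, ⊤)) := by
    have h₁ := congrArg (fun f : triv X Γ(E, ⊤) ⟶ structureModule X =>
      f.app ⊤ (constVec ((c i)⁻¹ • s i))) hφ
    have h₂ : (ev E).app ⊤ (constVec ((c i)⁻¹ • s i)) = (c i)⁻¹ • s i :=
      trivDesc_app_top_constVec LinearMap.id _
    refine (congrArg (φ.app ⊤) h₂).symm.trans (h₁.trans
      ((trivDesc_app_top_constVec (M := structureModule X) _ _).trans ?_))
    change scalarHom X ⊤ (ξ ((c i)⁻¹ • s i)) = 1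
    rw [map_smul, hξ, smul_eq_mul, inv_mul_cancel₀ hi, map_one]
  exact (TrivialSummand.ofHom φ _ hv).not_isMuStable hr hE n H hstable

end Stable

end

end StableBundle

theorem proposition1p1 (X : Scheme.{0}) [X.Over (Spec (CommRingCat.of ℂ))] [IsIntegral X]
    [Smooth (X ↘ Spec (CommRingCat.of ℂ))] (hproj : StableBundle.IsProjective X)
    (n : ℕ) (hn : 2 ≤ n) (hdim : topologicalKrullDim X = n)
    (H : X.Modules) (hH : StableBundle.IsAmple H)
    (r : ℕ) (hr : 2 ≤ r) (E : X.Modules) (hE : StableBundle.IsVectorBundle r E)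
    (hgen : StableBundle.IsGloballyGenerated E)
    (hsec : Module.finrank ℂ Γ(E, ⊤) = r + 1)
    (hstable : StableBundle.IsMuStable n H E) :
    Function.Injective (StableBundle.detMap r E) ∧
      Nonempty (StableBundle.DualEvaluation r E) ∧
      ∀ D : StableBundle.DualEvaluation r E,
        LinearMap.range (StableBundle.detMap r E) = LinearMap.range (StableBundle.H0map D.γ) := by
  have : Module.Finite ℂ Γ(E, ⊤) := Module.finite_of_finrank_pos (by omega)
  let s := Module.finBasisOfFinrankEq ℂ Γ(E, ⊤) hsec
  exact ⟨StableBundle.injective_detMap hr hE hgen s hstable,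
    ⟨StableBundle.minorDualEvaluation hE hgen s⟩, fun D => D.range_detMap_eq hproj hE hgen s⟩
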